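/- **Setting.** Let $\Omega\subset\mathbb R^2$ be open and let $\partial_D\Omega\subset\partial\Omega$ be nonempty and relatively open. Let $\widehat T$ be the closed unit triangle (resp. unit square), let $k\ge 2$, and let $\widehat{\mathbb V}^k=\mathbb P_k$ (polynomials of total degree $\le k$) (resp. $\mathbb Q_k$, degree $\le k$ in each variable). Let $\mathcal T_h$ be a finite mesh of closed elements $T=F_T(\widehat T)$, with $F_T\in[\widehat{\mathbb V}^k]^2$ injective on $\widehat T$, the sets $F_T(\operatorname{int}\widehat T)\subset\Omega$ pairwise disjoint and $\bigcup_T T=\overline\Omega$; hanging nodes are allowed. Put $h_T=\operatorname{diam}T$. Let the mesh be shape regular with constant $\sigma$, i.e. $\|DF_T\|\le\sigma h_T$ and $\|(DF_T)^{-1}\|\le\sigma/h_T$ on $\widehat T$, and let $h$ be a measurable mesh density function with $\sigma^{-1}h_T\le h\le\sigma h_T$ on each $T$. $\mathbb V_h^k$ is the space of functions $v_h$, given separately on each element, with $v_h\circ F_T\in\widehat{\mathbb V}^k$ for all $T$; the operators $\nabla_h,D^2_h,\Delta_h,\operatorname{div}$ act elementwise. $\mathcal E_h$ consists of the interior edges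 (contained in $\Omega$, common to two elements) and the boundary edges contained in $\partial_D\Omega$; $\Gamma_h$ is their union. On an interior edge $e$ let $\mu=\mu_e$ be one of its two unit normals, $v^\pm(x)=\lim_{s\to0^+}v(x\pm s\mu_e)$, $[v]=v^--v^+$, $\{v\}=\frac12(v^++v^-)$. On a boundary edge, $\mu_e$ is the outward unit normal and $\{v\}=v^-$ is the value from $\Omega$. Let $g\in[H^1(\Omega)]^3$, $\Phi\in[H^1(\Omega)]^{3\times2}$, $f\in[L^2(\Omega)]^3$. That $y_h\in\mathbb V_h^k(g,\Phi)$ means that $y_h\in[\mathbb V_h^k]^3$ and that on boundary edges the jumps are $[y_h]:=y_h-g$ and $[\nabla_hy_h]:=\nabla_hy_h-\Phi$ (traces of $g,\Phi$). For penalty parameters $\gamma_0,\gamma_1$ the discrete energy is $$\begin{aligned}E_h[y_h]={}&\tfrac12\|D_h^2y_h\|_{L^2(\Omega)}^2-\big(\{\partial_\mu\nabla_hy_h\},[\nabla_hy_h]\big)_{L^2(\Gamma_h)}+\big(\{\partial_\mu\Delta_hy_h\},[y_h]\big)_{L^2(\Gamma_h)}\\&+\tfrac{\gamma_1}2\|h^{-1/2}[\nabla_hy_h]\|_{L^2(\Gamma_h)}^2+\tfrac{\gamma_0}2\|h^{-3/2}[y_h]\|_{L^2(\Gamma_h)}^2-(f,y_h)_{L^2(\Omega)}.\end{aligned}$$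 Let $\mathbb H_h^k$ be the space of $\tau_h$ with $\tau_h|_T=D^2w_T$, $w_T\in\mathbb V_h^k(T)$, on every $T$. For $e\in\mathcal E_h$ let $\omega(e)$ be the union of the (one or two) elements adjacent to $e$. For $\phi\in[L^2(e)]^2$ (resp. $\phi\in L^2(e)$) let $r_e(\phi)$ (resp. $b_e(\phi)$) be the element of $\mathbb H_h^k(\omega(e))$, extended by zero, with $$\int_{\omega(e)}r_e(\phi):\tau_h=\int_e\phi\cdot\{\tau_h\}\mu_e,\qquad \int_{\omega(e)}b_e(\phi):\tau_h=\int_e\phi\,\{\operatorname{div}\tau_h\}\cdot\mu_e\qquad\forall\,\tau_h\in\mathbb H_h^k(\omega(e)).$$ Componentwise, set $H_h[y_h]:=D_h^2y_h-\sum_{e}r_e([\nabla_hy_h])+\sum_{e}b_e([y_h])$. **Proposition.** There is a constant $\gamma_*>0$, depending only on the kind of reference element, on $k$ and on $\sigma$, such that for all $\gamma_0,\gamma_1\ge\gamma_*$, all $\Omega,\partial_D\Omega,\mathcal T_h,h,g,\Phi,f$ as above and all $y_h\in\mathbb V_h^k(g,\Phi)$, $$\tfrac12\|H_h[y_h]\|_{L^2(\Omega)}^2-(f,y_h)_{L^2(\Omega)}\le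 E_h[y_h].$$ -/

import Mathlib

open MeasureTheory Filter Topology
open scoped ENNReal ContDiff

noncomputable section

namespace PlateDG

/-- The Euclidean plane. -/
abbrev Pt := EuclideanSpace ℝ (Fin 2)

/-- The `j`-th partial derivative of `u` relative to the set `T`. On a closed element `T` this is the
classical derivative in the interior, extended by one-sided derivatives to the boundary of `T`; for
`T = univ` it is the usual partial derivative. -/
def pd (T : Set Pt) (j : Fin 2) (u : Pt → ℝ) : Pt → ℝ :=
  fun x => fderivWithin ℝ u T x (EuclideanSpace.single j 1)

/-! ### Sobolev functions and traces -/

/-- `w ∈ L²(U)` is the weak `j`-th partial derivative of `u` in the open set `U`. -/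
def HasWeakPartial (U : Set Pt) (j : Fin 2) (u w : Pt → ℝ) : Prop :=
  MemLp w 2 (volume.restrict U) ∧
    ∀ φ : Pt → ℝ, ContDiff ℝ ∞ φ → HasCompactSupport φ → tsupport φ ⊆ U →
      ∫ x in U, u x * pd Set.univ j φ x = -∫ x in U, w x * φ x

/-- `u ∈ H¹(U)`. -/
def MemH1 (U : Set Pt) (u : Pt → ℝ) : Prop :=
  MemLp u 2 (volume.restrict U) ∧ ∀ j, ∃ w, HasWeakPartial U j u w

/-- `t ∈ L²(S)` (arc length) is the trace on `S ⊆ ∂U` of `u ∈ H¹(U)`: some smooth functions on the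
plane converge to `u` in `H¹(U)` while their restrictions to `S` converge to `t` in `L²(S)`. -/
def IsTrace (U S : Set Pt) (u t : Pt → ℝ) : Prop :=
  MemLp t 2 ((μH[1]).restrict S) ∧
  ∃ w : Fin 2 → Pt → ℝ, (∀ j, HasWeakPartial U j u (w j)) ∧
  ∃ φ : ℕ → Pt → ℝ, (∀ m, ContDiff ℝ ∞ (φ m)) ∧
    Tendsto (fun m => eLpNorm (φ m - u) 2 (volume.restrict U)) atTop (𝓝 0) ∧
    (∀ j, Tendsto (fun m => eLpNorm (pd Set.univ j (φ m) - w j) 2 (volume.restrict U))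
      atTop (𝓝 0)) ∧
    Tendsto (fun m => eLpNorm (φ m - t) 2 ((μH[1]).restrict S)) atTop (𝓝 0)

open Classical in
/-- The trace of `u` on `S ⊆ ∂U` (unique up to null sets of `S`). It is only used for `u ∈ H¹(U)`,
`U` the interior of a mesh element and `S` a part of one of its sides, where the trace exists. -/
def trace (U S : Set Pt) (u : Pt → ℝ) : Pt → ℝ :=
  if h : ∃ t, IsTrace U S u t then h.choose else 0

/-! ### Reference elements -/

/-- The two kinds of reference element: unit triangle and unit square. -/
inductive Shape
  | triangle
  | square

namespace Shape

/-- Number of sides. -/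
abbrev sides : Shape → ℕ
  | triangle => 3
  | square => 4

/-- Outward normals (not normalized) to the sides of the reference element. -/
def normal : (s : Shape) → Fin s.sides → Pt
  | triangle => ![!₂[0, -1], !₂[-1, 0], !₂[1, 1]]
  | square => ![!₂[0, -1], !₂[-1, 0], !₂[0, 1], !₂[1, 0]]

/-- The side `a` lies on the line `⟪normal a, x⟫ = offset a`. -/
def offset : (s : Shape) → Fin s.sides → ℝ
  | triangle => ![0, 0, 1]
  | square => ![0, 0, 1, 1]

/-- The closed reference element: the unit triangle `{x₀, x₁ ≥ 0, x₀ + x₁ ≤ 1}` or the unit square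
`[0,1]²`. -/
def ref (s : Shape) : Set Pt := {x | ∀ a, inner ℝ (s.normal a) x ≤ s.offset a}

/-- The interior of the reference element. -/
def refInterior (s : Shape) : Set Pt := {x | ∀ a, inner ℝ (s.normal a) x < s.offset a}

/-- The side `a` of the reference element, without its end points. -/
def refSide (s : Shape) (a : Fin s.sides) : Set Pt :=
  {x | inner ℝ (s.normal a) x = s.offset a ∧
    ∀ b, b ≠ a → inner ℝ (s.normal b) x < s.offset b}

/-- `ℙ_k` (total degree at most `k`) on the triangle, `ℚ_k` (degree at most `k` in each variable) on
the square. -/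
def polys : Shape → ℕ → Submodule ℝ (MvPolynomial (Fin 2) ℝ)
  | triangle, k => MvPolynomial.restrictTotalDegree (Fin 2) ℝ k
  | square, k => MvPolynomial.restrictDegree (Fin 2) ℝ k

end Shape

/-! ### Meshes -/

/-- An isoparametric mesh of degree `k` that represents `Ω` exactly: finitely many closed elements
`T = F_T(T̂)` with `F_T` in `[ℙ_k]²` (resp. `[ℚ_k]²`). Hanging nodes are allowed. -/
structure Mesh (S : Shape) (k : ℕ) (Ω : Set Pt) where
  /-- number of elements -/
  N : ℕ
  /-- element maps -/
  F : Fin N → Pt → Pt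
  F_poly : ∀ T j, ∃ p ∈ S.polys k, ∀ x : Pt, F T x j = MvPolynomial.eval (fun i => x i) p
  F_inj : ∀ T, Set.InjOn (F T) S.ref
  disjoint_interiors : ∀ T T', T ≠ T' → Disjoint (F T '' S.refInterior) (F T' '' S.refInterior)
  interior_subset : ∀ T, F T '' S.refInterior ⊆ Ω
  cover : ⋃ T, F T '' S.ref = closure Ω

namespace Mesh

variable {S : Shape} {k : ℕ} {Ω : Set Pt} (M : Mesh S k Ω)

/-- The closed element `T`. -/
def elem (T : Fin M.N) : Set Pt := M.F T '' S.ref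

/-- The interior of the element `T`. -/
def elemInterior (T : Fin M.N) : Set Pt := M.F T '' S.refInterior

/-- The diameter `h_T`. -/
def size (T : Fin M.N) : ℝ := Metric.diam (M.elem T)

/-- Shape regularity with constant `σ`: on the reference element `‖DF_T‖ ≤ σ h_T`, and `DF_T` is
invertible with `‖(DF_T)⁻¹‖ ≤ σ / h_T`. -/
def ShapeRegular (σ : ℝ) : Prop :=
  ∀ T, ∀ x ∈ S.ref, ‖fderiv ℝ (M.F T) x‖ ≤ σ * M.size T ∧
    ∀ v : Pt, M.size T * ‖v‖ ≤ σ * ‖fderiv ℝ (M.F T) x v‖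

/-- `h` is a mesh density function: locally equivalent to the element size, with constant `σ`. -/
def IsDensity (σ : ℝ) (h : Pt → ℝ) : Prop :=
  Measurable h ∧ ∀ T, ∀ x ∈ M.elem T, M.size T ≤ σ * h x ∧ h x ≤ σ * M.size T

/-- A side of an element: the element and the number of the side. -/
abbrev Side := Fin M.N × Fin S.sides

/-- The point set of a side, without its end points. -/
def sideSet (s : M.Side) : Set Pt := M.F s.1 '' S.refSide s.2

/-- Outward unit normal to the element `s.1` along its side `s.2`: the normalized vector
`DF_T(x̂)^{-T} n̂` at the point `x = F_T(x̂)`, where `n̂` is a reference normal. -/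
def outNormal (s : M.Side) (x : Pt) : Pt :=
  let ν : Pt := (ContinuousLinearMap.adjoint
    (fderiv ℝ (M.F s.1) (Function.invFunOn (M.F s.1) S.ref x))).inverse (S.normal s.2)
  ‖ν‖⁻¹ • ν

/-- Indices of edges. `(s, some s')` stands for the interior edge in which the sides `s` and `s'` of
two elements meet, `(s, none)` for the boundary edge in which the side `s` meets `∂Ω`. -/
abbrev EdgeIdx := M.Side × Option M.Side

/-- The point set of an active edge (without end points). Every pair of elements is used once, in the
order of their numbers. Interior edges are those in `Ω`, boundary edges those contained in the
Dirichlet part `ΓD`; all other indices give the empty set. -/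
def edge (ΓD : Set Pt) : M.EdgeIdx → Set Pt
  | (s, some s') => {x | s.1 < s'.1 ∧ x ∈ M.sideSet s ∩ M.sideSet s' ∩ Ω}
  | (s, none) => {x | x ∈ M.sideSet s ∩ frontier Ω ∧ M.sideSet s ∩ frontier Ω ⊆ ΓD}

/-- The unit normal `μ_e`: it is outward to the first element of the edge, which is therefore the one
on the side `-` of the edge. -/
def edgeNormal (e : M.EdgeIdx) : Pt → Pt := M.outNormal e.1

/-- The elements of the patch `ω(e)`. -/
def patch : M.EdgeIdx → Finset (Fin M.N)
  | (s, some s') => {s.1, s'.1}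
  | (s, none) => {s.1}

/-! ### Elementwise functions -/

/-- A (scalar) function that is given separately on each closed element, as are discontinuous
functions over the mesh. Only the values of `u T` on `T` matter. -/
abbrev Broken := Fin M.N → Pt → ℝ

/-- The space `𝕍_h^k`: on each element the function composed with `F_T` is in `ℙ_k` (resp. `ℚ_k`). -/
def MemV (v : M.Broken) : Prop :=
  ∀ T, ∃ p ∈ S.polys k, ∀ x ∈ S.ref, v T (M.F T x) = MvPolynomial.eval (fun i => x i) p

/-- Elementwise partial derivative. -/
def dh (j : Fin 2) (u : M.Broken) : M.Broken := fun T => pd (M.elem T) j (u T)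

/-- The broken Hessian `D²_h u`. -/
def hess (u : M.Broken) : Fin 2 → Fin 2 → M.Broken := fun i j => M.dh i (M.dh j u)

/-- The broken Laplacian. -/
def lap (u : M.Broken) : M.Broken := ∑ i, M.dh i (M.dh i u)

/-- The elementwise (row-wise) divergence of a tensor field. -/
def div (τ : Fin 2 → Fin 2 → M.Broken) (i : Fin 2) : M.Broken := ∑ j, M.dh j (τ i j)

/-- The `L²(Ω)` inner product of elementwise functions. -/
def ip (u v : M.Broken) : ℝ := ∑ T, ∫ x in M.elem T, u T x * v T x

/-- The average `{u}` on an edge. -/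
def avg (u : M.Broken) : M.EdgeIdx → Pt → ℝ
  | (s, some s') => fun x => (u s.1 x + u s'.1 x) / 2
  | (s, none) => u s.1

/-- The jump `[u]` on an edge: `u⁻ - u⁺` on interior edges and `u - d` on boundary edges, where `d` is
(the trace of) the boundary datum. -/
def jump (ΓD : Set Pt) (d : Pt → ℝ) (u : M.Broken) : M.EdgeIdx → Pt → ℝ
  | (s, some s') => fun x => u s.1 x - u s'.1 x
  | (s, none) => fun x => u s.1 x - trace (M.elemInterior s.1) (M.edge ΓD (s, none)) d x

/-- The `L²(Γ_h)` inner product with respect to arc length over the skeleton `Γ_h` of active edges. -/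
def ipSkel (ΓD : Set Pt) (φ ψ : M.EdgeIdx → Pt → ℝ) : ℝ :=
  ∑ e, ∫ x in M.edge ΓD e, φ e x * ψ e x ∂μH[1]

/-! ### Liftings and the discrete Hessian (for one scalar component) -/

/-- `τ ∈ ℍ_h^k`: on every element `τ` is the Hessian of a function of `𝕍_h^k`. -/
def MemHess (τ : Fin 2 → Fin 2 → M.Broken) : Prop :=
  ∃ w, M.MemV w ∧ ∀ T, ∀ x ∈ M.elem T, ∀ i j, τ i j T x = M.hess w i j T x

/-- `τ ∈ ℍ_h^k(ω(e))`, extended by zero outside `ω(e)`, represents the functional `ℓ`: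
`∫_{ω(e)} τ : η = ℓ(η)` for all `η ∈ ℍ_h^k`. -/
def IsLift (e : M.EdgeIdx) (ℓ : (Fin 2 → Fin 2 → M.Broken) → ℝ)
    (τ : Fin 2 → Fin 2 → M.Broken) : Prop :=
  M.MemHess τ ∧ (∀ T, T ∉ M.patch e → ∀ i j, τ i j T = 0) ∧
    ∀ η, M.MemHess η →
      ∑ T ∈ M.patch e, ∫ x in M.elem T, ∑ i, ∑ j, τ i j T x * η i j T x = ℓ η

open Classical in
/-- The element of `ℍ_h^k(ω(e))` representing the functional `ℓ` (unique as a function on `ω(e)`). -/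
def lift (e : M.EdgeIdx) (ℓ : (Fin 2 → Fin 2 → M.Broken) → ℝ) : Fin 2 → Fin 2 → M.Broken :=
  if h : ∃ τ, M.IsLift e ℓ τ then h.choose else 0

/-- The local lifting `r_e(φ)` of a vector field `φ` on `e`:
`∫_{ω(e)} r_e(φ) : η = ∫_e φ · {η} μ_e`. -/
def liftR (ΓD : Set Pt) (e : M.EdgeIdx) (φ : Fin 2 → Pt → ℝ) : Fin 2 → Fin 2 → M.Broken :=
  M.lift e fun η => ∫ x in M.edge ΓD e,
    ∑ i, φ i x * ∑ j, M.avg (η i j) e x * M.edgeNormal e x j ∂μH[1]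

/-- The local lifting `b_e(φ)` of a function `φ` on `e`:
`∫_{ω(e)} b_e(φ) : η = ∫_e φ {div η} · μ_e`. -/
def liftB (ΓD : Set Pt) (e : M.EdgeIdx) (φ : Pt → ℝ) : Fin 2 → Fin 2 → M.Broken :=
  M.lift e fun η => ∫ x in M.edge ΓD e,
    φ x * ∑ i, M.avg (M.div η i) e x * M.edgeNormal e x i ∂μH[1]

/-- The discrete Hessian `D²_h y - ∑_e r_e([∇_h y]) + ∑_e b_e([y])` of a scalar component `y` with
boundary data `g` and `Φ`. -/
def discreteHessian (ΓD : Set Pt) (g : Pt → ℝ) (Φ : Fin 2 → Pt → ℝ) (y : M.Broken) :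
    Fin 2 → Fin 2 → M.Broken :=
  M.hess y - ∑ e, M.liftR ΓD e (fun j => M.jump ΓD (Φ j) (M.dh j y) e)
    + ∑ e, M.liftB ΓD e (M.jump ΓD g y e)

/-! ### The discrete energy -/

/-- The `j`-th component of `{∂_μ ∇_h u}`. -/
def avgNormalGrad (u : M.Broken) (j : Fin 2) (e : M.EdgeIdx) (x : Pt) : ℝ :=
  ∑ i, M.avg (M.hess u i j) e x * M.edgeNormal e x i

/-- `{∂_μ Δ_h u}`. -/
def avgNormalLap (u : M.Broken) (e : M.EdgeIdx) (x : Pt) : ℝ :=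
  ∑ i, M.avg (M.dh i (M.lap u)) e x * M.edgeNormal e x i

/-- The form `a_h(y, v)` for scalar components `y` and `v`, whose boundary jumps are taken with
respect to the data `(g, Φ)` and `(g', Φ')`. -/
def form (ΓD : Set Pt) (h : Pt → ℝ) (γ₀ γ₁ : ℝ)
    (g : Pt → ℝ) (Φ : Fin 2 → Pt → ℝ) (y : M.Broken)
    (g' : Pt → ℝ) (Φ' : Fin 2 → Pt → ℝ) (v : M.Broken) : ℝ :=
  ∑ i, ∑ j, M.ip (M.hess y i j) (M.hess v i j)
  - ∑ j, M.ipSkel ΓD (M.avgNormalGrad y j) (M.jump ΓD (Φ' j) (M.dh j v))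
  - ∑ j, M.ipSkel ΓD (M.avgNormalGrad v j) (M.jump ΓD (Φ j) (M.dh j y))
  + M.ipSkel ΓD (M.avgNormalLap y) (M.jump ΓD g' v)
  + M.ipSkel ΓD (M.avgNormalLap v) (M.jump ΓD g y)
  + γ₁ * ∑ j, M.ipSkel ΓD (fun e x => (h x)⁻¹ * M.jump ΓD (Φ j) (M.dh j y) e x)
      (M.jump ΓD (Φ' j) (M.dh j v))
  + γ₀ * M.ipSkel ΓD (fun e x => (h x ^ 3)⁻¹ * M.jump ΓD g y e x) (M.jump ΓD g' v)

/-- The load term `(f, y)_{L²(Ω)}`. -/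
def load (f : Fin 3 → Pt → ℝ) (y : Fin 3 → M.Broken) : ℝ :=
  ∑ n, M.ip (fun _ => f n) (y n)

/-- The discrete energy `E_h[y] = ½ a_h(y, y) - (f, y)` of a vector-valued `y` with boundary data
`(g, Φ)`. -/
def energy (ΓD : Set Pt) (h : Pt → ℝ) (γ₀ γ₁ : ℝ)
    (g : Fin 3 → Pt → ℝ) (Φ : Fin 3 → Fin 2 → Pt → ℝ) (f : Fin 3 → Pt → ℝ)
    (y : Fin 3 → M.Broken) : ℝ :=
  1 / 2 * ∑ n, M.form ΓD h γ₀ γ₁ (g n) (Φ n) (y n) (g n) (Φ n) (y n) - M.load f y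

/-- `‖H_h[y]‖²_{L²(Ω)}` for a vector-valued `y` with boundary data `(g, Φ)`. -/
def hessianNormSq (ΓD : Set Pt) (g : Fin 3 → Pt → ℝ) (Φ : Fin 3 → Fin 2 → Pt → ℝ)
    (y : Fin 3 → M.Broken) : ℝ :=
  ∑ n, ∑ i, ∑ j, M.ip (M.discreteHessian ΓD (g n) (Φ n) (y n) i j)
    (M.discreteHessian ΓD (g n) (Φ n) (y n) i j)

end Mesh

end PlateDG

end

/-! The components of `y` decouple and the load cancels, so the claim is `‖H_h[y]‖² ≤ a_h(y, y)` for
one scalar component (`exists_threshold`). Write `H_h[y] = D + Q`, where `D` is the broken Hessian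
and `Q` is the sum of all lifted jumps with their signs. Since `D` itself lies in `ℍ_h^k`, it may be
used as a test field in the definition of the liftings: `(Q, D) = L(D)`, a sum of edge integrals. By
the symmetry of second and third derivatives these are exactly the consistency terms of `a_h`.
Expanding the square therefore gives `‖H_h[y]‖² - a_h(y, y) = ‖Q‖² - γ₁ J₁ - γ₀ J₀`, with `J₁`, `J₀`
the weighted squared jumps, and only a stability bound `‖Q‖² ≤ A (J₁ + J₀)` is needed.

For this bound, `Q` is tested with itself: `‖Q‖² = L(Q)`. Young's inequality with weights `h` and
`h³` and inverse estimates on the patches (`edgeB_sub_edgeR_le`) give `L(Q) ≤ A/2 (J₁ + J₀) + K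
n/(2A) ‖Q‖²`, where `n` bounds the number of active edges whose patch contains a given element. With
`A = K n + 1` the last term is absorbed.

The inverse estimates must be uniform over curved elements. In reference coordinates derivatives of
discrete functions are not polynomials but quotients `q / J ^ m`, with `J` the Jacobian determinant
(`IsRat`). Differentiation acts on the numerators by an explicit rule (`isRat_pd`) with controlled
degree, so norm equivalence for polynomials of fixed degree on the reference element, together with
the bounds on `DF` and `J`, yields `exists_inverse_estimate`. Edge terms are bounded by pointwise
values times the length of the edge, so an edge may be any part of a side and hanging nodes do no
harm.

The overlap is finite because touching elements have comparable sizes, both being compared with `h`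
at a common point, and disjoint interiors of comparable area fit only boundedly often into a ball
(`exists_card_touching_le`).

Finally, `lift` is a representer only if one exists. Existence (`exists_isLift`) follows from linear
algebra on the coefficient space, where the Hessian form is merely semidefinite but the edge
functionals vanish on its kernel. -/

noncomputable section

namespace PlateDG

/-! ### Linear algebra -/

/-- A linear functional that vanishes on the kernel of a symmetric bilinear form on a
finite-dimensional space is represented by the form. -/
theorem exists_represents {V : Type*} [AddCommGroup V] [Module ℝ V] [FiniteDimensional ℝ V]
    (B : V →ₗ[ℝ] V →ₗ[ℝ] ℝ) (symm : ∀ v w, B v w = B w v) (l : V →ₗ[ℝ] ℝ)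
    (hl : ∀ v, B v v = 0 → l v = 0) : ∃ w, ∀ v, B w v = l v := by
  have h : l ∈ (LinearMap.ker B).dualAnnihilator := by
    rw [Submodule.mem_dualAnnihilator]
    intro v hv
    rw [LinearMap.mem_ker] at hv
    exact hl v (by rw [hv]; rfl)
  rw [LinearMap.dualAnnihilator_ker_eq_range_flip] at h
  obtain ⟨w, hw⟩ := h
  exact ⟨w, fun v => by rw [symm, ← hw]; rfl⟩

/-- On a finite-dimensional space every linear functional is bounded with respect to a positive
definite bilinear form. -/
theorem exists_sq_le {V : Type*} [AddCommGroup V] [Module ℝ V] [FiniteDimensional ℝ V]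
    (B : V →ₗ[ℝ] V →ₗ[ℝ] ℝ) (symm : ∀ v w, B v w = B w v) (pos : ∀ v, 0 ≤ B v v)
    (l : V →ₗ[ℝ] ℝ) (hl : ∀ v, B v v = 0 → v = 0) : ∃ C, 0 ≤ C ∧ ∀ v, l v ^ 2 ≤ C * B v v := by
  obtain ⟨w, hw⟩ := exists_represents B symm l fun v hv => by rw [hl v hv, map_zero]
  -- The constant comes from the representer `w` of `l`; the bound is the Cauchy–Schwarz inequality.
  refine ⟨B w w, pos w, fun v => ?_⟩
  have := LinearMap.BilinForm.apply_mul_apply_le_of_forall_zero_le B pos w v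
  rw [symm v w, hw] at this
  linarith [sq (l v)]

/-! ### Polynomial functions on the plane -/

/-- Polynomials in two variables. -/
abbrev Poly := MvPolynomial (Fin 2) ℝ

/-- The polynomial function on the plane. -/
def ev (p : Poly) (x : Pt) : ℝ := MvPolynomial.eval (fun i => x i) p

@[simp] theorem ev_add (p q : Poly) (x : Pt) : ev (p + q) x = ev p x + ev q x := map_add _ _ _
@[simp] theorem ev_sub (p q : Poly) (x : Pt) : ev (p - q) x = ev p x - ev q x := map_sub _ _ _
@[simp] theorem ev_neg (p : Poly) (x : Pt) : ev (-p) x = -ev p x := map_neg _ _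
@[simp] theorem ev_mul (p q : Poly) (x : Pt) : ev (p * q) x = ev p x * ev q x := map_mul _ _ _
@[simp] theorem ev_zero (x : Pt) : ev 0 x = 0 := map_zero _
@[simp] theorem ev_one (x : Pt) : ev 1 x = 1 := map_one _
@[simp] theorem ev_smul (c : ℝ) (p : Poly) (x : Pt) : ev (c • p) x = c * ev p x :=
  MvPolynomial.smul_eval _ _ _

theorem ev_sum {ι : Type*} (s : Finset ι) (p : ι → Poly) (x : Pt) :
    ev (∑ i ∈ s, p i) x = ∑ i ∈ s, ev (p i) x := map_sum _ _ _

/-- The partial derivatives of a polynomial. -/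
abbrev pder (i : Fin 2) : Derivation ℝ Poly Poly := MvPolynomial.pderiv i

/-- The commutator of two derivations is a derivation, so it is enough that it kills the variables.
-/
theorem pder_comm (i j : Fin 2) (p : Poly) : pder i (pder j p) = pder j (pder i p) := by
  have h : ⁅pder i, pder j⁆ = 0 := by
    refine MvPolynomial.derivation_ext fun n => ?_
    rw [Derivation.commutator_apply]
    simp only [pder, MvPolynomial.pderiv_X, Pi.single_apply]
    split_ifs <;> simp
  have := DFunLike.congr_fun h p
  rw [Derivation.commutator_apply] at this
  exact sub_eq_zero.mp this

theorem totalDegree_pder_le (i : Fin 2) (p : Poly) : (pder i p).totalDegree ≤ p.totalDegree := by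
  refine Finset.sup_le fun m hm => ?_
  rw [MvPolynomial.mem_support_iff, MvPolynomial.coeff_pderiv] at hm
  have h := MvPolynomial.le_totalDegree
    (MvPolynomial.mem_support_iff.mpr (left_ne_zero_of_mul hm))
  rw [Finsupp.sum_add_index' (fun _ => rfl) (fun _ _ _ => rfl)] at h
  omega

theorem hasFDerivAt_ev (p : Poly) (x : Pt) :
    HasFDerivAt (ev p) (∑ i, ev (pder i p) x • (EuclideanSpace.proj i : Pt →L[ℝ] ℝ)) x := by
  induction p using MvPolynomial.induction_on with
  | C a =>
    have : ev (MvPolynomial.C a) = fun _ => a := by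
      funext y; exact MvPolynomial.eval_C _
    rw [this]
    refine (hasFDerivAt_const a x).congr_fderiv ?_
    simp
  | add p q hp hq =>
    have : ev (p + q) = fun y => ev p y + ev q y := by funext y; simp
    rw [this]
    refine (hp.add hq).congr_fderiv ?_
    simp only [map_add, ev_add, add_smul, Finset.sum_add_distrib]
  | mul_X p n hp =>
    have : ev (p * MvPolynomial.X n) = fun y => ev p y * y n := by
      funext y; rw [ev_mul]; congr 1; exact MvPolynomial.eval_X _
    rw [this]
    have hX : HasFDerivAt (fun y : Pt => y n) (EuclideanSpace.proj n : Pt →L[ℝ] ℝ) x :=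
      (EuclideanSpace.proj n : Pt →L[ℝ] ℝ).hasFDerivAt
    refine (hp.mul hX).congr_fderiv ?_
    have e : ev (MvPolynomial.X n) x = x n := MvPolynomial.eval_X _
    ext v
    simp only [Derivation.leibniz, ev_add, smul_eq_mul, ev_mul, e, add_smul,
      MvPolynomial.pderiv_X, Pi.single_apply]
    fin_cases n <;> simp [Fin.sum_univ_two] <;> ring

theorem continuous_ev (p : Poly) : Continuous (ev p) :=
  continuous_iff_continuousAt.mpr fun x => (hasFDerivAt_ev p x).continuousAt

/-! ### Geometry of the reference elements -/

namespace Shape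

theorem mem_ref_triangle {x : Pt} : x ∈ triangle.ref ↔ 0 ≤ x 1 ∧ 0 ≤ x 0 ∧ x 0 + x 1 ≤ 1 := by
  simp [ref, normal, offset, Fin.forall_fin_succ, PiLp.inner_apply, Fin.sum_univ_two, add_comm]

theorem mem_ref_square {x : Pt} :
    x ∈ square.ref ↔ 0 ≤ x 1 ∧ 0 ≤ x 0 ∧ x 1 ≤ 1 ∧ x 0 ≤ 1 := by
  simp [ref, normal, offset, Fin.forall_fin_succ, PiLp.inner_apply, Fin.sum_univ_two]

theorem mem_refInterior_triangle {x : Pt} :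
    x ∈ triangle.refInterior ↔ 0 < x 1 ∧ 0 < x 0 ∧ x 0 + x 1 < 1 := by
  simp [refInterior, normal, offset, Fin.forall_fin_succ, PiLp.inner_apply, Fin.sum_univ_two,
    add_comm]

theorem mem_refInterior_square {x : Pt} :
    x ∈ square.refInterior ↔ 0 < x 1 ∧ 0 < x 0 ∧ x 1 < 1 ∧ x 0 < 1 := by
  simp [refInterior, normal, offset, Fin.forall_fin_succ, PiLp.inner_apply, Fin.sum_univ_two]

variable (S : Shape)

theorem isClosed_ref : IsClosed S.ref := by
  rw [ref, Set.ofPred_forall]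
  exact isClosed_iInter fun a => isClosed_le (by fun_prop) continuous_const

theorem convex_ref : Convex ℝ S.ref := by
  rw [ref, Set.ofPred_forall]
  exact convex_iInter fun a => convex_halfSpace_le (innerₗ Pt (S.normal a)).isLinear _

theorem isOpen_refInterior : IsOpen S.refInterior := by
  rw [refInterior, Set.ofPred_forall]
  exact isOpen_iInter_of_finite fun a => isOpen_lt (by fun_prop) continuous_const

theorem refInterior_subset : S.refInterior ⊆ S.ref := fun _ hx a => (hx a).le

theorem refSide_subset (a : Fin S.sides) : S.refSide a ⊆ S.ref := fun x hx b => by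
  by_cases h : b = a
  · rw [h]; exact hx.1.le
  · exact (hx.2 b h).le

theorem measurableSet_refSide (a : Fin S.sides) : MeasurableSet (S.refSide a) := by
  rw [refSide, Set.ofPred_and]
  refine MeasurableSet.inter (isClosed_eq (by fun_prop) continuous_const).measurableSet ?_
  simp only [Set.ofPred_forall]
  exact MeasurableSet.iInter fun b => MeasurableSet.iInter fun _ =>
    (isOpen_lt (by fun_prop) continuous_const).measurableSet

theorem abs_apply_le_one {x : Pt} (hx : x ∈ S.ref) (i : Fin 2) : |x i| ≤ 1 := by
  rw [abs_le]
  cases S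
  · rw [mem_ref_triangle] at hx
    fin_cases i <;> constructor <;> dsimp only [Fin.zero_eta, Fin.mk_one] <;> linarith
  · rw [mem_ref_square] at hx
    fin_cases i <;> constructor <;> dsimp only [Fin.zero_eta, Fin.mk_one] <;> linarith

theorem isCompact_ref : IsCompact S.ref := by
  refine Metric.isCompact_of_isClosed_isBounded S.isClosed_ref ?_
  refine (Metric.isBounded_closedBall (x := (0 : Pt)) (r := 2)).subset fun x hx => ?_
  rw [mem_closedBall_zero_iff, EuclideanSpace.norm_eq, Real.sqrt_le_left (by norm_num),
    Fin.sum_univ_two]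
  have h0 := S.abs_apply_le_one hx 0
  have h1 := S.abs_apply_le_one hx 1
  rw [Real.norm_eq_abs, Real.norm_eq_abs]
  nlinarith [abs_nonneg (x 0), abs_nonneg (x 1)]

/-- A product of intervals common to both shapes: polynomials are determined by their values on it.
-/
theorem mem_refInterior_of_mem_Ioo {x : Pt} (hx : ∀ i, x i ∈ Set.Ioo (0 : ℝ) (1 / 2)) :
    x ∈ S.refInterior := by
  have h0 := hx 0
  have h1 := hx 1
  rw [Set.mem_Ioo] at h0 h1
  cases S
  · rw [mem_refInterior_triangle]
    refine ⟨?_, ?_, ?_⟩ <;> linarith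
  · rw [mem_refInterior_square]
    refine ⟨?_, ?_, ?_, ?_⟩ <;> linarith

theorem refInterior_nonempty : S.refInterior.Nonempty :=
  ⟨!₂[1 / 4, 1 / 4], S.mem_refInterior_of_mem_Ioo fun i => by
    fin_cases i <;> constructor <;> norm_num⟩

theorem interior_ref_nonempty : (interior S.ref).Nonempty :=
  S.refInterior_nonempty.mono (interior_maximal S.refInterior_subset S.isOpen_refInterior)

theorem uniqueDiffOn_ref : UniqueDiffOn ℝ S.ref :=
  uniqueDiffOn_convex S.convex_ref S.interior_ref_nonempty

theorem volume_ref_lt_top : volume S.ref < ⊤ := S.isCompact_ref.measure_lt_top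

theorem volume_refInterior_pos : 0 < volume.real S.refInterior :=
  ENNReal.toReal_pos (S.isOpen_refInterior.measure_pos volume S.refInterior_nonempty).ne'
    ((measure_mono S.refInterior_subset).trans_lt S.volume_ref_lt_top).ne

/-- Every side of a reference element lies on a line segment. -/
theorem refSide_subset_segment (a : Fin S.sides) :
    ∃ A B : Pt, S.refSide a ⊆ (fun t : ℝ => A + t • B) '' Set.Icc 0 1 := by
  have key : ∀ (A B : Pt) (i : Fin 2), (∀ x ∈ S.refSide a, ∀ j, x j = A j + x i * B j) →
      (∀ x ∈ S.refSide a, 0 ≤ x i) →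
      ∃ A B : Pt, S.refSide a ⊆ (fun t : ℝ => A + t • B) '' Set.Icc 0 1 :=
    fun A B i h hi => ⟨A, B, fun x hx => ⟨x i, ⟨hi x hx,
      (le_abs_self _).trans (S.abs_apply_le_one (S.refSide_subset a hx) i)⟩, by
        ext j; simp [h x hx j]⟩⟩
  have hn : ∀ x ∈ S.refSide a, ∀ i, 0 ≤ x i := by
    intro x hx i
    have := S.refSide_subset a hx
    cases S
    · rw [mem_ref_triangle] at this
      fin_cases i; exacts [this.2.1, this.1]
    · rw [mem_ref_square] at this
      fin_cases i; exacts [this.2.1, this.1]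
  have on : ∀ x ∈ S.refSide a, (S.normal a) 0 * x 0 + (S.normal a) 1 * x 1 = S.offset a := by
    intro x hx
    rw [← hx.1, PiLp.inner_apply, Fin.sum_univ_two]
    simp [mul_comm]
  cases S <;> fin_cases a <;> simp only [normal, offset] at on <;> simp at on
  · refine key !₂[0, 0] !₂[1, 0] 0 (fun x hx j => ?_) fun x hx => hn x hx 0
    fin_cases j <;> simp [on x hx]
  · refine key !₂[0, 0] !₂[0, 1] 1 (fun x hx j => ?_) fun x hx => hn x hx 1
    fin_cases j <;> simp [on x hx]
  · refine key !₂[0, 1] !₂[1, -1] 0 (fun x hx j => ?_) fun x hx => hn x hx 0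
    fin_cases j <;> simp
    linarith [on x hx]
  · refine key !₂[0, 0] !₂[1, 0] 0 (fun x hx j => ?_) fun x hx => hn x hx 0
    fin_cases j <;> simp [on x hx]
  · refine key !₂[0, 0] !₂[0, 1] 1 (fun x hx j => ?_) fun x hx => hn x hx 1
    fin_cases j <;> simp [on x hx]
  · refine key !₂[0, 1] !₂[1, 0] 0 (fun x hx j => ?_) fun x hx => hn x hx 0
    fin_cases j <;> simp [on x hx]
  · refine key !₂[1, 0] !₂[0, 1] 1 (fun x hx j => ?_) fun x hx => hn x hx 1
    fin_cases j <;> simp [on x hx]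

theorem hausdorffMeasure_refSide_lt_top (a : Fin S.sides) : μH[1] (S.refSide a) < ⊤ := by
  obtain ⟨A, B, h⟩ := S.refSide_subset_segment a
  have hL : LipschitzWith ‖B‖₊ (fun t : ℝ => A + t • B) := by
    refine LipschitzWith.of_dist_le_mul fun s t => ?_
    rw [dist_add_left, dist_eq_norm, ← sub_smul, norm_smul, mul_comm, coe_nnnorm,
      Real.dist_eq, Real.norm_eq_abs]
  refine (measure_mono h).trans_lt ((hL.lipschitzOnWith.hausdorffMeasure_image_le
    zero_le_one).trans_lt ?_)
  rw [hausdorffMeasure_real] 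
  simp

/-- Since `ℚ_k ⊆ ℙ_{2k}`, both shapes can be treated with one bound on the total degree. -/
theorem totalDegree_le_of_mem_polys (k : ℕ) (p : Poly) (hp : p ∈ S.polys k) :
    p.totalDegree ≤ 2 * k := by
  cases S
  · exact ((MvPolynomial.mem_restrictTotalDegree _ _ _).mp hp).trans (by omega)
  · refine Finset.sup_le fun m hm => ?_
    have := (MvPolynomial.mem_restrictDegree _ _ _).mp hp m hm
    rw [Finsupp.sum_fintype _ _ fun _ => rfl, Fin.sum_univ_two]
    have h0 := this 0
    have h1 := this 1
    omega

instance finiteDimensional_polys (k : ℕ) : FiniteDimensional ℝ (S.polys k) := by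
  cases S
  · exact inferInstanceAs (Module.Finite ℝ (MvPolynomial.restrictTotalDegree (Fin 2) ℝ k))
  · exact inferInstanceAs (Module.Finite ℝ (MvPolynomial.restrictDegree (Fin 2) ℝ k))

/-! ### Norm equivalence for polynomials -/

/-- By continuity the polynomial vanishes on the open interior, hence on a product of two infinite
sets. -/
theorem eq_zero_of_integral_sq_eq_zero {p : Poly} (h : ∫ x in S.ref, ev p x ^ 2 = 0) : p = 0 := by
  have hc : Continuous fun x => ev p x ^ 2 := (continuous_ev p).pow 2
  rw [setIntegral_eq_zero_iff_of_nonneg_ae (ae_of_all _ fun _ => sq_nonneg _)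
    (hc.continuousOn.integrableOn_compact S.isCompact_ref)] at h
  have h' := ae_restrict_of_ae_restrict_of_subset S.refInterior_subset h
  have h2 := Measure.eqOn_open_of_ae_eq h' S.isOpen_refInterior hc.continuousOn
    continuousOn_const
  refine MvPolynomial.funext_set (fun _ => Set.Ioo (0 : ℝ) (1 / 2))
    (fun _ => Set.Ioo_infinite (by norm_num)) fun x hx => ?_
  have := h2 (S.mem_refInterior_of_mem_Ioo (x := WithLp.toLp 2 x) fun i => hx i trivial)
  rw [map_zero]
  exact pow_eq_zero_iff two_ne_zero |>.mp this

/-- Norm equivalence on polynomials of bounded degree: values and gradients on the reference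
element are controlled by the `L²` norm. -/
theorem exists_sq_le_integral (n : ℕ) : ∃ C, 0 < C ∧ ∀ p : Poly, p.totalDegree ≤ n →
    ∀ x ∈ S.ref, ev p x ^ 2 ≤ C * ∫ y in S.ref, ev p y ^ 2 ∧
      ∀ i, ev (pder i p) x ^ 2 ≤ C * ∫ y in S.ref, ev p y ^ 2 := by
  let V := MvPolynomial.restrictTotalDegree (Fin 2) ℝ n
  have int : ∀ p q : Poly, IntegrableOn (fun x => ev p x * ev q x) S.ref := fun p q =>
    ((continuous_ev p).mul (continuous_ev q)).continuousOn.integrableOn_compact S.isCompact_ref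
  let B : V →ₗ[ℝ] V →ₗ[ℝ] ℝ := LinearMap.mk₂ ℝ (fun p q => ∫ x in S.ref, ev p x * ev q x)
    (fun p p' q => by
      simp only [Submodule.coe_add, ev_add, add_mul]
      exact integral_add (int _ _) (int _ _))
    (fun c p q => by
      simp only [Submodule.coe_smul, ev_smul, smul_eq_mul, mul_assoc]
      exact integral_const_mul _ _)
    (fun p q q' => by
      simp only [Submodule.coe_add, ev_add, mul_add]
      exact integral_add (int _ _) (int _ _))
    (fun c p q => by
      simp only [Submodule.coe_smul, ev_smul, smul_eq_mul, mul_left_comm _ c]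
      exact integral_const_mul _ _)
  have hB : ∀ p q : V, B p q = ∫ x in S.ref, ev p x * ev q x := fun _ _ => rfl
  have hBB : ∀ p : V, B p p = ∫ x in S.ref, ev p x ^ 2 := fun p => by
    simp only [hB, sq]
  let b := Module.finBasis ℝ V
  have hb : ∀ i, ∃ C, 0 ≤ C ∧ ∀ v : V, b.repr v i ^ 2 ≤ C * B v v := fun i =>
    exists_sq_le B (fun v w => by simp only [hB, mul_comm])
      (fun v => by rw [hBB]; exact integral_nonneg fun _ => sq_nonneg _) (b.coord i)
      fun v hv => Subtype.ext (S.eq_zero_of_integral_sq_eq_zero (by rwa [hBB] at hv))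
  choose C hC hCb using hb
  -- Expansion in a basis: the coordinates are controlled by the `L²` norm, the images of the basis
  -- by compactness. The identity and the two partial derivatives are the cases of interest.
  have main : ∀ L : Poly →ₗ[ℝ] Poly, ∃ D, 0 ≤ D ∧ ∀ p : V, ∀ x ∈ S.ref,
      ev (L p) x ^ 2 ≤ D * B p p := by
    intro L
    have hM : ∀ i, ∃ M, ∀ x ∈ S.ref, |ev (L (b i)) x| ≤ M := fun i =>
      S.isCompact_ref.exists_bound_of_continuousOn (continuous_ev _).continuousOn
    choose M hM using hM
    refine ⟨(Module.finrank ℝ V : ℝ) * ∑ i, C i * M i ^ 2, mul_nonneg (Nat.cast_nonneg _)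
      (Finset.sum_nonneg fun i _ => mul_nonneg (hC i) (sq_nonneg _)), fun p x hx => ?_⟩
    have e : ev (L p) x = ∑ i, b.repr p i * ev (L (b i)) x := by
      conv_lhs => rw [← b.sum_repr p]
      simp only [Submodule.coe_sum, map_sum, ev_sum, Submodule.coe_smul, map_smul, ev_smul]
    rw [e]
    refine (sq_sum_le_card_mul_sum_sq (s := Finset.univ)).trans ?_
    rw [Finset.card_univ, Fintype.card_fin, mul_assoc, Finset.sum_mul]
    refine mul_le_mul_of_nonneg_left (Finset.sum_le_sum fun i _ => ?_) (Nat.cast_nonneg _)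
    rw [mul_pow, mul_right_comm]
    exact mul_le_mul (hCb i p) (sq_le_sq' (abs_le.mp (hM i x hx)).1 (abs_le.mp (hM i x hx)).2)
      (sq_nonneg _) ((sq_nonneg _).trans (hCb i p))
  obtain ⟨D, hD, h⟩ := main LinearMap.id
  obtain ⟨D0, hD0, h0⟩ := main (pder 0).toLinearMap
  obtain ⟨D1, hD1, h1⟩ := main (pder 1).toLinearMap
  refine ⟨D + D0 + D1 + 1, by positivity, fun p hp x hx => ?_⟩
  let q : V := ⟨p, (MvPolynomial.mem_restrictTotalDegree _ _ _).mpr hp⟩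
  have hI : 0 ≤ ∫ y in S.ref, ev p y ^ 2 := integral_nonneg fun _ => sq_nonneg _
  have H := h q x hx
  have H0 := h0 q x hx
  have H1 := h1 q x hx
  rw [hBB] at H H0 H1
  have up : ∀ E, E ≤ D + D0 + D1 + 1 → E * ∫ y in S.ref, ev p y ^ 2 ≤
      (D + D0 + D1 + 1) * ∫ y in S.ref, ev p y ^ 2 := fun E hE =>
    mul_le_mul_of_nonneg_right hE hI
  refine ⟨H.trans (up _ (by linarith)), fun i => ?_⟩
  fin_cases i
  · exact H0.trans (up _ (by linarith))
  · exact H1.trans (up _ (by linarith))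

end Shape

/-! ### Derivatives of pulled back functions -/

/-- The inverse of a continuous injective map on a compact set is continuous. -/
theorem continuousOn_invFunOn {X Y : Type*} [TopologicalSpace X] [TopologicalSpace Y] [T2Space Y]
    [Nonempty X] {f : X → Y} {s : Set X} (hs : IsCompact s) (hf : ContinuousOn f s)
    (hi : Set.InjOn f s) : ContinuousOn (Function.invFunOn f s) (f '' s) := by
  rw [continuousOn_iff_isClosed]
  intro t ht
  refine ⟨f '' (s ∩ t), ((hs.inter_right ht).image_of_continuousOn
    (hf.mono Set.inter_subset_left)).isClosed, ?_⟩
  ext y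
  constructor
  · rintro ⟨hy, x, hx, rfl⟩
    rw [Set.mem_preimage, hi.leftInvOn_invFunOn hx] at hy
    exact ⟨⟨x, ⟨hx, hy⟩, rfl⟩, x, hx, rfl⟩
  · rintro ⟨⟨x, ⟨hx, hxt⟩, rfl⟩, -⟩
    exact ⟨by rwa [Set.mem_preimage, hi.leftInvOn_invFunOn hx], x, hx, rfl⟩

theorem contDiff_ev (p : Poly) : ContDiff ℝ ∞ (ev p) := by
  induction p using MvPolynomial.induction_on with
  | C a =>
    have : ev (MvPolynomial.C a) = fun _ => a := by
      funext y; exact MvPolynomial.eval_C _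
    rw [this]
    exact contDiff_const
  | add p q hp hq =>
    have : ev (p + q) = fun y => ev p y + ev q y := by funext y; simp
    rw [this]
    exact hp.add hq
  | mul_X p n hp =>
    have : ev (p * MvPolynomial.X n) = fun y => ev p y * y n := by
      funext y; rw [ev_mul]; congr 1; exact MvPolynomial.eval_X _
    rw [this]
    exact hp.mul (EuclideanSpace.proj n : Pt →L[ℝ] ℝ).contDiff

/-! ### Symbolic differentiation in image coordinates -/

section Symbolic

variable (φ : Fin 2 → Poly)

/-- The Jacobian determinant of the map with components `φ`. -/
def jac : Poly := pder 0 (φ 0) * pder 1 (φ 1) - pder 1 (φ 0) * pder 0 (φ 1)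

/-- `cof φ j i` is the entry `(i, j)` of the adjugate of the Jacobian matrix of `φ`. -/
def cof : Fin 2 → Fin 2 → Poly :=
  ![![pder 1 (φ 1), -pder 0 (φ 1)], ![-pder 1 (φ 0), pder 0 (φ 0)]]

/-- The derivation `jac φ • ∂_j`, where `∂_j` is the partial derivative in the image coordinates. -/
def pushDer (j : Fin 2) : Derivation ℝ Poly Poly := cof φ j 0 • pder 0 + cof φ j 1 • pder 1

theorem pushDer_apply (j : Fin 2) (q : Poly) :
    pushDer φ j q = cof φ j 0 * pder 0 q + cof φ j 1 * pder 1 q := rfl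

/-- If `u ∘ F = q / jac ^ m`, then `∂_j u ∘ F = pdNum φ j m q / jac ^ (m + 2)`. -/
def pdNum (j : Fin 2) (m : ℕ) : Poly →ₗ[ℝ] Poly where
  toFun q := jac φ * pushDer φ j q - (m : ℝ) • (q * pushDer φ j (jac φ))
  map_add' p q := by simp only [map_add, add_mul, smul_add]; ring
  map_smul' c q := by
    rw [Derivation.map_smul, RingHom.id_apply, smul_sub, smul_mul_assoc, mul_smul_comm, smul_comm]

theorem pdNum_apply (j : Fin 2) (m : ℕ) (q : Poly) :
    pdNum φ j m q = jac φ * pushDer φ j q - (m : ℝ) • (q * pushDer φ j (jac φ)) := rfl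

/-- With `pushDer φ j = J ∂_j` and commuting `∂₀`, `∂₁`, the commutator is `J (∂₀J ∂₁ - ∂₁J ∂₀)`.
The factor `J` on the left makes this an identity between polynomials. -/
theorem jac_mul_commutator (q : Poly) :
    jac φ * (pushDer φ 0 (pushDer φ 1 q) - pushDer φ 1 (pushDer φ 0 q)) =
      pushDer φ 0 (jac φ) * pushDer φ 1 q - pushDer φ 1 (jac φ) * pushDer φ 0 q := by
  simp only [pushDer_apply, cof, jac, Matrix.cons_val_zero, Matrix.cons_val_one, map_add, map_sub,
    map_neg, Derivation.leibniz, smul_eq_mul, pder_comm 1 0]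
  ring

/-- Schwarz's theorem for the numerators: the difference of the two sides is a combination of the
commutator identities for `q` and for the Jacobian determinant. -/
theorem pdNum_comm (i j : Fin 2) (m : ℕ) (q : Poly) :
    pdNum φ i (m + 2) (pdNum φ j m q) = pdNum φ j (m + 2) (pdNum φ i m q) := by
  have key : pdNum φ 0 (m + 2) (pdNum φ 1 m q) = pdNum φ 1 (m + 2) (pdNum φ 0 m q) := by
    have h1 := jac_mul_commutator φ q
    have h2 := jac_mul_commutator φ (jac φ)
    simp only [pdNum_apply, map_sub, Derivation.map_smul, Derivation.leibniz, smul_eq_mul]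
    simp only [MvPolynomial.smul_eq_C_mul, Nat.cast_add, map_add]
    have h3 : (MvPolynomial.C ((2 : ℕ) : ℝ) : Poly) = 2 := map_natCast MvPolynomial.C 2
    rw [h3]
    linear_combination jac φ * h1 - MvPolynomial.C (m : ℝ) * q * h2
  fin_cases i <;> fin_cases j
  · rfl
  · exact key
  · exact key.symm
  · rfl

theorem totalDegree_pushDer_le {n d : ℕ} (hφ : ∀ j, (φ j).totalDegree ≤ n) (j : Fin 2) {q : Poly}
    (hq : q.totalDegree ≤ d) : (pushDer φ j q).totalDegree ≤ n + d := by
  have hc : ∀ i, (cof φ j i).totalDegree ≤ n := by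
    intro i
    fin_cases j <;> fin_cases i <;>
      simp only [cof, Fin.zero_eta, Fin.mk_one, Matrix.cons_val_zero, Matrix.cons_val_one,
        MvPolynomial.totalDegree_neg] <;> exact (totalDegree_pder_le _ _).trans (hφ _)
  have hm : ∀ i, (cof φ j i * pder i q).totalDegree ≤ n + d := fun i =>
    (MvPolynomial.totalDegree_mul _ _).trans
      (add_le_add (hc i) ((totalDegree_pder_le i q).trans hq))
  rw [pushDer_apply]
  exact (MvPolynomial.totalDegree_add _ _).trans (max_le (hm 0) (hm 1))

theorem totalDegree_jac_le {n : ℕ} (hφ : ∀ j, (φ j).totalDegree ≤ n) :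
    (jac φ).totalDegree ≤ n + n := by
  have hm : ∀ i j i' j', (pder i (φ j) * pder i' (φ j')).totalDegree ≤ n + n :=
    fun i j i' j' => (MvPolynomial.totalDegree_mul _ _).trans
      (add_le_add ((totalDegree_pder_le _ _).trans (hφ _)) ((totalDegree_pder_le _ _).trans (hφ _)))
  exact (MvPolynomial.totalDegree_sub _ _).trans (max_le (hm _ _ _ _) (hm _ _ _ _))

theorem totalDegree_pdNum_le {n d : ℕ} (hφ : ∀ j, (φ j).totalDegree ≤ n) (j : Fin 2) (m : ℕ)
    {q : Poly} (hq : q.totalDegree ≤ d) : (pdNum φ j m q).totalDegree ≤ 3 * n + d := by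
  have hj := totalDegree_jac_le φ hφ
  rw [pdNum_apply]
  refine (MvPolynomial.totalDegree_sub _ _).trans (max_le ?_ ?_)
  · have := totalDegree_pushDer_le φ hφ j hq
    exact (MvPolynomial.totalDegree_mul _ _).trans (by omega)
  · have := totalDegree_pushDer_le φ hφ j hj
    exact (MvPolynomial.totalDegree_smul_le _ _).trans
      ((MvPolynomial.totalDegree_mul _ _).trans (by omega))

end Symbolic

/-! ### A single element -/

/-- The data of one shape regular element of size `H`. -/
structure IsElement (S : Shape) (k : ℕ) (σ H : ℝ) (φ : Fin 2 → Poly) (F : Pt → Pt) : Prop where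
  totalDegree_le : ∀ j, (φ j).totalDegree ≤ 2 * k
  apply_eq : ∀ x j, F x j = ev (φ j) x
  injOn : Set.InjOn F S.ref
  size_pos : 0 < H
  regularity_pos : 0 < σ
  norm_fderiv_le : ∀ x ∈ S.ref, ‖fderiv ℝ F x‖ ≤ σ * H
  le_norm_fderiv : ∀ x ∈ S.ref, ∀ v, H * ‖v‖ ≤ σ * ‖fderiv ℝ F x v‖

/-- On the element `F '' S.ref`, the function `u` is the push forward of the rational function
`q / jac φ ^ m`. -/
def IsRat (S : Shape) (φ : Fin 2 → Poly) (F : Pt → Pt) (m : ℕ) (q : Poly) (u : Pt → ℝ) : Prop :=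
  ∀ x ∈ S.ref, u (F x) = ev q x / ev (jac φ) x ^ m

theorem IsRat.congr {S : Shape} {φ : Fin 2 → Poly} {F : Pt → Pt} {m : ℕ} {q : Poly}
    {u v : Pt → ℝ} (hu : IsRat S φ F m q u)
    (h : ∀ y ∈ F '' S.ref, v y = u y) : IsRat S φ F m q v := fun x hx => by
  rw [h _ ⟨x, hx, rfl⟩, hu x hx]

theorem IsRat.eq {S : Shape} {φ : Fin 2 → Poly} {F : Pt → Pt} {m : ℕ} {q : Poly}
    {u v : Pt → ℝ} (hu : IsRat S φ F m q u)
    (hv : IsRat S φ F m q v) {y : Pt} (hy : y ∈ F '' S.ref) : u y = v y := by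
  obtain ⟨x, hx, rfl⟩ := hy
  rw [hu x hx, hv x hx]

namespace IsElement

variable {S : Shape} {k : ℕ} {σ H : ℝ} {φ : Fin 2 → Poly} {F : Pt → Pt}

theorem contDiff (E : IsElement S k σ H φ F) : ContDiff ℝ ∞ F := by
  rw [contDiff_euclidean]
  intro j
  simp only [E.apply_eq]
  exact contDiff_ev _

theorem hasFDerivAt (E : IsElement S k σ H φ F) (x : Pt) : HasFDerivAt F (fderiv ℝ F x) x :=
  ((E.contDiff.differentiable (by simp)) x).hasFDerivAt

theorem continuous (E : IsElement S k σ H φ F) : Continuous F := E.contDiff.continuous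

theorem fderiv_apply (E : IsElement S k σ H φ F) (x v : Pt) (i : Fin 2) :
    fderiv ℝ F x v i = ev (pder 0 (φ i)) x * v 0 + ev (pder 1 (φ i)) x * v 1 := by
  have h1 := (EuclideanSpace.proj i : Pt →L[ℝ] ℝ).hasFDerivAt.comp x (E.hasFDerivAt x)
  have h2 : HasFDerivAt (fun y => F y i) _ x :=
    (hasFDerivAt_ev (φ i) x).congr_of_eventuallyEq 
      (Eventually.of_forall fun y => E.apply_eq y i)
  have := DFunLike.congr_fun (h1.unique h2) v
  simpa [Fin.sum_univ_two] using this

theorem det_fderiv (E : IsElement S k σ H φ F) (x : Pt) : (fderiv ℝ F x).det = ev (jac φ) x := by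
  rw [ContinuousLinearMap.det,
    ← LinearMap.det_toMatrix (EuclideanSpace.basisFun (Fin 2) ℝ).toBasis, Matrix.det_fin_two]
  simp [LinearMap.toMatrix_apply, E.fderiv_apply, jac]

/-- Cramer's rule: `DF · adj DF = J · I`, read column by column. It gives `DF⁻¹` as a quotient of
polynomials. -/
theorem fderiv_cof (E : IsElement S k σ H φ F) (x : Pt) (j : Fin 2) :
    fderiv ℝ F x !₂[ev (cof φ j 0) x, ev (cof φ j 1) x] =
      ev (jac φ) x • EuclideanSpace.single j 1 := by
  ext i
  rw [E.fderiv_apply]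
  fin_cases j <;> fin_cases i <;> simp [cof, jac, ev_neg] <;> ring

/-! ### Size of the Jacobian matrix and its determinant -/

theorem sq_ev_pder_le (E : IsElement S k σ H φ F) {x : Pt} (hx : x ∈ S.ref) (l i : Fin 2) :
    ev (pder l (φ i)) x ^ 2 ≤ (σ * H) ^ 2 := by
  have h1 : fderiv ℝ F x (EuclideanSpace.single l 1) i = ev (pder l (φ i)) x := by
    rw [E.fderiv_apply]
    fin_cases l <;> simp
  have h2 := (PiLp.norm_apply_le (fderiv ℝ F x (EuclideanSpace.single l 1)) i).trans
    ((fderiv ℝ F x).le_opNorm _)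
  rw [h1, PiLp.norm_single, norm_one, mul_one, Real.norm_eq_abs] at h2
  rw [← sq_abs]
  exact pow_le_pow_left₀ (abs_nonneg _) (h2.trans (E.norm_fderiv_le x hx)) 2

theorem sq_ev_cof_le (E : IsElement S k σ H φ F) {x : Pt} (hx : x ∈ S.ref) (j i : Fin 2) :
    ev (cof φ j i) x ^ 2 ≤ (σ * H) ^ 2 := by
  fin_cases j <;> fin_cases i <;> simp only [cof, Fin.zero_eta, Fin.mk_one, Matrix.cons_val_zero,
    Matrix.cons_val_one, ev_neg, neg_sq] <;> exact E.sq_ev_pder_le hx _ _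

theorem sq_jac_le (E : IsElement S k σ H φ F)
    {x : Pt} (hx : x ∈ S.ref) : ev (jac φ) x ^ 2 ≤ 4 * σ ^ 4 * H ^ 4 := by
  have a := E.sq_ev_pder_le hx 0 0
  have b := E.sq_ev_pder_le hx 1 1
  have c := E.sq_ev_pder_le hx 1 0
  have d := E.sq_ev_pder_le hx 0 1
  have ab := mul_le_mul a b (sq_nonneg _) (sq_nonneg _)
  have cd := mul_le_mul c d (sq_nonneg _) (sq_nonneg _)
  simp only [jac, ev_sub, ev_mul]
  nlinarith [sq_nonneg (ev (pder 0 (φ 0)) x * ev (pder 1 (φ 1)) x +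
    ev (pder 1 (φ 0)) x * ev (pder 0 (φ 1)) x)]

/-- The lower bound on `DF` is applied to both cofactor columns, whose images are `J e_j`, and to
`e₀`. The entries of `DF e₀` are, up to sign, cofactors, so the estimates chain; the factor 2 comes
from using both columns. -/
theorem le_sq_jac (E : IsElement S k σ H φ F)
    {x : Pt} (hx : x ∈ S.ref) : H ^ 4 ≤ 2 * σ ^ 4 * ev (jac φ) x ^ 2 := by
  have sq : ∀ v, H ^ 2 * (v 0 ^ 2 + v 1 ^ 2) ≤
      σ ^ 2 * (fderiv ℝ F x v 0 ^ 2 + fderiv ℝ F x v 1 ^ 2) := by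
    intro v
    have := pow_le_pow_left₀ (mul_nonneg E.size_pos.le (norm_nonneg _)) (E.le_norm_fderiv x hx v) 2
    simpa [mul_pow, EuclideanSpace.norm_sq_eq, Fin.sum_univ_two] using this
  have h0 := sq !₂[ev (cof φ 0 0) x, ev (cof φ 0 1) x]
  have h1 := sq !₂[ev (cof φ 1 0) x, ev (cof φ 1 1) x]
  rw [E.fderiv_cof] at h0 h1
  have h2 := sq (EuclideanSpace.single 0 1)
  simp only [E.fderiv_apply] at h2
  simp [cof, ev_neg] at h0 h1 h2
  have hH := sq_nonneg H
  have hσ := sq_nonneg σ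
  nlinarith [mul_le_mul_of_nonneg_left h2 hH, mul_le_mul_of_nonneg_left h0 hσ,
    mul_le_mul_of_nonneg_left h1 hσ,
    mul_nonneg hσ (mul_nonneg hH (sq_nonneg (ev (pder 1 (φ 0)) x))),
    mul_nonneg hσ (mul_nonneg hH (sq_nonneg (ev (pder 1 (φ 1)) x)))]

theorem jac_ne_zero (E : IsElement S k σ H φ F) {x : Pt} (hx : x ∈ S.ref) : ev (jac φ) x ≠ 0 := by
  intro h
  have := E.le_sq_jac hx
  rw [h] at this
  have h4 : 0 < H ^ 4 := pow_pos E.size_pos 4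
  linarith

theorem le_abs_jac (E : IsElement S k σ H φ F)
    {x : Pt} (hx : x ∈ S.ref) : H ^ 2 ≤ 2 * σ ^ 2 * |ev (jac φ) x| := by
  refine le_of_sq_le_sq ?_ (by positivity)
  have := E.le_sq_jac hx
  rw [mul_pow, sq_abs]
  nlinarith [mul_nonneg (pow_nonneg E.regularity_pos.le 4) (sq_nonneg (ev (jac φ) x))]

theorem isCompact_image (E : IsElement S k σ H φ F) :
    IsCompact (F '' S.ref) := S.isCompact_ref.image E.continuous

theorem invFunOn_apply (E : IsElement S k σ H φ F)
    {x : Pt} (hx : x ∈ S.ref) : Function.invFunOn F S.ref (F x) = x :=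
  E.injOn.leftInvOn_invFunOn hx

theorem continuousOn_inv (E : IsElement S k σ H φ F) :
    ContinuousOn (Function.invFunOn F S.ref) (F '' S.ref) :=
  continuousOn_invFunOn S.isCompact_ref E.continuous.continuousOn E.injOn

/-- The derivative of the element map as an isomorphism. -/
theorem exists_equiv (E : IsElement S k σ H φ F) {x : Pt} (hx : x ∈ S.ref) :
    ∃ e : Pt ≃L[ℝ] Pt, (e : Pt →L[ℝ] Pt) = fderiv ℝ F x :=
  ⟨(fderiv ℝ F x).toContinuousLinearEquivOfDetNeZero (by
    rw [E.det_fderiv]; exact E.jac_ne_zero hx), by ext; simp⟩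

/-- One-sided derivatives at the boundary of a curved element are thereby determined: the property
passes from the convex reference element through the invertible `DF`. -/
theorem uniqueDiffWithinAt (E : IsElement S k σ H φ F) {x : Pt} (hx : x ∈ S.ref) :
    UniqueDiffWithinAt ℝ (F '' S.ref) (F x) := by
  obtain ⟨e, he⟩ := E.exists_equiv hx
  have := (E.hasFDerivAt x).hasFDerivWithinAt (s := S.ref)
  rw [← he] at this
  exact this.uniqueDiffWithinAt_of_continuousLinearEquiv e (S.uniqueDiffOn_ref x hx)

/-- Chain rule for `u = r ∘ F⁻¹`, valid up to the boundary: the inverse on the closed element is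
continuous, hence differentiable within it, and `DF⁻¹ e_j` is the cofactor column divided by `J`. -/
theorem pd_eq (E : IsElement S k σ H φ F)
    {x : Pt} (hx : x ∈ S.ref) {u r : Pt → ℝ} {r' : Pt →L[ℝ] ℝ} (hr : HasFDerivAt r r' x)
    (hu : ∀ z ∈ S.ref, u (F z) = r z) (j : Fin 2) :
    pd (F '' S.ref) j u (F x) =
      r' !₂[ev (cof φ j 0) x, ev (cof φ j 1) x] / ev (jac φ) x := by
  obtain ⟨e, he⟩ := E.exists_equiv hx
  have hF : F x ∈ F '' S.ref := ⟨x, hx, rfl⟩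
  have hG : HasFDerivWithinAt (Function.invFunOn F S.ref) (e.symm : Pt →L[ℝ] Pt)
      (F '' S.ref) (F x) := by
    refine HasFDerivWithinAt.of_local_left_inverse (t := Set.univ) (f := F) ?_ ?_ hF ?_
    · rw [nhdsWithin_univ]
      exact E.continuousOn_inv (F x) hF
    · rw [E.invFunOn_apply hx, he]
      exact (E.hasFDerivAt x).hasFDerivWithinAt
    · filter_upwards [self_mem_nhdsWithin] with y hy using Function.invFunOn_eq hy
  have hr2 : HasFDerivAt r r' (Function.invFunOn F S.ref (F x)) := by rwa [E.invFunOn_apply hx]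
  have hu' : HasFDerivWithinAt u (r'.comp (e.symm : Pt →L[ℝ] Pt)) (F '' S.ref) (F x) := by
    refine (hr2.comp_hasFDerivWithinAt _ hG).congr' (fun y hy => ?_) hF
    rw [Function.comp_apply, ← hu _ (Function.invFunOn_mem hy), Function.invFunOn_eq hy]
  have hv : e.symm (EuclideanSpace.single j 1) =
      (ev (jac φ) x)⁻¹ • !₂[ev (cof φ j 0) x, ev (cof φ j 1) x] := by
    rw [ContinuousLinearEquiv.symm_apply_eq, map_smul]
    have := E.fderiv_cof x j
    rw [← he] at this
    erw [this]
    rw [smul_smul, inv_mul_cancel₀ (E.jac_ne_zero hx), one_smul]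
  rw [pd, hu'.fderivWithin (E.uniqueDiffWithinAt hx)]
  change r' (e.symm _) = _
  rw [hv, map_smul, smul_eq_mul, div_eq_inv_mul]

theorem isRat_pd (E : IsElement S k σ H φ F)
    {m : ℕ} {q : Poly} {u : Pt → ℝ} (hu : IsRat S φ F m q u) (j : Fin 2) :
    IsRat S φ F (m + 2) (pdNum φ j m q) (pd (F '' S.ref) j u) := by
  intro x hx
  have hJ := E.jac_ne_zero hx
  have hr := (hasFDerivAt_ev q x).mul
    ((hasDerivAt_inv (pow_ne_zero m hJ)).comp_hasFDerivAt x ((hasFDerivAt_ev (jac φ) x).pow m))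
  rw [E.pd_eq hx hr (fun z hz => by rw [hu z hz]; rfl) j]
  simp only [pdNum_apply, pushDer_apply, ev_sub, ev_mul, ev_add, ev_smul]
  simp [Fin.sum_univ_two]
  -- The derivative of `J ^ m` contains the truncated exponent `m - 1`, so `m = 0` is separate.
  rcases m with _ | m
  · simp; field_simp
  · field_simp
    simp
    ring

theorem continuousOn_of_isRat (E : IsElement S k σ H φ F)
    {m : ℕ} {q : Poly} {u : Pt → ℝ} (hu : IsRat S φ F m q u) :
    ContinuousOn u (F '' S.ref) := by
  have h1 : ContinuousOn (fun x => ev q x / ev (jac φ) x ^ m) S.ref :=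
    (continuous_ev q).continuousOn.div ((continuous_ev _).pow m).continuousOn
      fun x hx => pow_ne_zero m (E.jac_ne_zero hx)
  refine (h1.comp E.continuousOn_inv fun y hy => Function.invFunOn_mem hy).congr fun y hy => ?_
  rw [Function.comp_apply, ← hu _ (Function.invFunOn_mem hy), Function.invFunOn_eq hy]

end IsElement

namespace IsElement

variable {S : Shape} {k : ℕ} {σ H : ℝ} {φ : Fin 2 → Poly} {F : Pt → Pt}

/-! ### Scaled estimates on one element -/

theorem integral_image (E : IsElement S k σ H φ F) (g : Pt → ℝ) :
    ∫ y in F '' S.ref, g y = ∫ x in S.ref, |ev (jac φ) x| * g (F x) := by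
  rw [integral_image_eq_integral_abs_det_fderiv_smul volume S.isClosed_ref.measurableSet
    (fun x _ => (E.hasFDerivAt x).hasFDerivWithinAt) E.injOn]
  simp only [E.det_fderiv, smul_eq_mul]

theorem le_volume_image (E : IsElement S k σ H φ F) :
    H ^ 2 * volume.real S.refInterior ≤ 2 * σ ^ 2 * volume.real (F '' S.refInterior) := by
  have hm := S.isOpen_refInterior.measurableSet
  have h1 := integral_image_eq_integral_abs_det_fderiv_smul volume hm
    (fun x _ => (E.hasFDerivAt x).hasFDerivWithinAt) (E.injOn.mono S.refInterior_subset)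
    (fun _ => (1 : ℝ))
  simp only [E.det_fderiv, smul_eq_mul, mul_one, setIntegral_const] at h1
  rw [h1, ← integral_const_mul]
  have hI : IntegrableOn (fun x => 2 * σ ^ 2 * |ev (jac φ) x|) S.refInterior :=
    (((continuous_ev _).abs.const_mul _).continuousOn.integrableOn_compact S.isCompact_ref).mono_set
      S.refInterior_subset
  have h2 : volume S.refInterior ≠ ⊤ :=
    ((measure_mono S.refInterior_subset).trans_lt S.volume_ref_lt_top).ne
  have := setIntegral_mono_on (μ := volume) (f := fun _ => H ^ 2) (integrableOn_const h2) hI hm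
    fun x hx => E.le_abs_jac (S.refInterior_subset hx)
  rwa [setIntegral_const, smul_eq_mul, mul_comm] at this

theorem volume_image_lt_top (E : IsElement S k σ H φ F) : volume (F '' S.refInterior) < ⊤ :=
  (measure_mono (Set.image_mono S.refInterior_subset)).trans_lt E.isCompact_image.measure_lt_top

theorem measurableSet_image (E : IsElement S k σ H φ F) {s : Set Pt} (hs : MeasurableSet s)
    (h : s ⊆ S.ref) : MeasurableSet (F '' s) :=
  hs.image_of_continuousOn_injOn E.continuous.continuousOn (E.injOn.mono h)

theorem hausdorffMeasure_image_le (E : IsElement S k σ H φ F) {s : Set Pt} (h : s ⊆ S.ref) :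
    μH[1] (F '' s) ≤ ENNReal.ofReal (σ * H) * μH[1] s := by
  have hL : LipschitzOnWith (Real.toNNReal (σ * H)) F S.ref :=
    S.convex_ref.lipschitzOnWith_of_nnnorm_fderiv_le
      (fun x _ => (E.hasFDerivAt x).differentiableAt) fun x hx => by
        rw [← NNReal.coe_le_coe, coe_nnnorm]
        exact (E.norm_fderiv_le x hx).trans (Real.le_coe_toNNReal _)
  have := (hL.mono h).hausdorffMeasure_image_le zero_le_one
  rw [ENNReal.rpow_one] at this
  exact this

theorem sq_pushDer_le (E : IsElement S k σ H φ F) {x : Pt} (hx : x ∈ S.ref) (j : Fin 2) {q : Poly}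
    {c : ℝ} (hq : ∀ i, ev (pder i q) x ^ 2 ≤ c) :
    ev (pushDer φ j q) x ^ 2 ≤ 4 * (σ * H) ^ 2 * c := by
  have h0 := mul_le_mul (E.sq_ev_cof_le hx j 0) (hq 0) (sq_nonneg _) (sq_nonneg _)
  have h1 := mul_le_mul (E.sq_ev_cof_le hx j 1) (hq 1) (sq_nonneg _) (sq_nonneg _)
  simp only [pushDer_apply, ev_add, ev_mul]
  nlinarith [sq_nonneg (ev (cof φ j 0) x * ev (pder 0 q) x - ev (cof φ j 1) x * ev (pder 1 q) x)]

theorem sq_pdNum_le (E : IsElement S k σ H φ F) {x : Pt} (hx : x ∈ S.ref) (j : Fin 2) {q : Poly}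
    {a b : ℝ} (h0 : ev q x ^ 2 ≤ a) (h1 : ∀ i, ev (pder i q) x ^ 2 ≤ a)
    (hJ : ∀ i, ev (pder i (jac φ)) x ^ 2 ≤ b * H ^ 4) :
    ev (pdNum φ j 4 q) x ^ 2 ≤ H ^ 6 * a * (32 * σ ^ 6 + 128 * σ ^ 2 * b) := by
  have ha : 0 ≤ a := (sq_nonneg _).trans h0
  have hJK := mul_le_mul (E.sq_jac_le hx) (E.sq_pushDer_le hx j h1) (sq_nonneg _)
    ((sq_nonneg _).trans (E.sq_jac_le hx))
  have hqK := mul_le_mul h0 (E.sq_pushDer_le hx j hJ) (sq_nonneg _) ha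
  rw [pdNum_apply, ev_sub, ev_mul, ev_smul, ev_mul]
  generalize ev (jac φ) x = J at *
  generalize ev (pushDer φ j q) x = K at *
  generalize ev (pushDer φ j (jac φ)) x = L at *
  generalize ev q x = Q at *
  have : (J * K - ((4 : ℕ) : ℝ) * (Q * L)) ^ 2 ≤ 2 * (J ^ 2 * K ^ 2) + 32 * (Q ^ 2 * L ^ 2) := by
    push_cast
    linarith [sq_nonneg (J * K + 4 * (Q * L))]
  linarith

/-- Here `q = J⁴ (u ∘ F)`: the factor `J⁸` costs `H¹⁶`, and inserting the Jacobian weight `|J|` of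
the change of variables gains `H²`. -/
theorem integral_sq_le (E : IsElement S k σ H φ F) {q : Poly} {u : Pt → ℝ}
    (hu : IsRat S φ F 4 q u) :
    ∫ x in S.ref, ev q x ^ 2 ≤
      2 * σ ^ 2 * (4 * σ ^ 4) ^ 4 * H ^ 14 * ∫ y in F '' S.ref, u y ^ 2 := by
  have hH := E.size_pos
  have hσ := E.regularity_pos
  have key : H ^ 2 * ∫ x in S.ref, ev q x ^ 2 ≤
      2 * σ ^ 2 * (4 * σ ^ 4 * H ^ 4) ^ 4 * ∫ y in F '' S.ref, u y ^ 2 := by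
    rw [E.integral_image, ← integral_const_mul, ← integral_const_mul]
    have hc : ContinuousOn (fun x => |ev (jac φ) x| * u (F x) ^ 2) S.ref :=
      (continuous_ev _).abs.continuousOn.mul
        (((E.continuousOn_of_isRat hu).comp E.continuous.continuousOn
          (Set.mapsTo_image F S.ref)).pow 2)
    refine setIntegral_mono_on
      ((((continuous_ev q).pow 2).continuousOn.integrableOn_compact S.isCompact_ref).const_mul _)
      ((hc.integrableOn_compact S.isCompact_ref).const_mul _) S.isClosed_ref.measurableSet
      fun x hx => ?_
    have hJ := E.jac_ne_zero hx
    have e : ev q x ^ 2 = (ev (jac φ) x ^ 2) ^ 4 * u (F x) ^ 2 := by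
      rw [hu x hx, div_pow, ← pow_mul, ← pow_mul, mul_div_cancel₀ _ (pow_ne_zero _ hJ)]
    have h2 := pow_le_pow_left₀ (sq_nonneg _) (E.sq_jac_le hx) 4
    have h3 := mul_le_mul (E.le_abs_jac hx) h2 (by positivity) (by positivity)
    rw [e]
    calc H ^ 2 * ((ev (jac φ) x ^ 2) ^ 4 * u (F x) ^ 2)
        = H ^ 2 * (ev (jac φ) x ^ 2) ^ 4 * u (F x) ^ 2 := by ring
      _ ≤ 2 * σ ^ 2 * |ev (jac φ) x| * (4 * σ ^ 4 * H ^ 4) ^ 4 * u (F x) ^ 2 :=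
          mul_le_mul_of_nonneg_right h3 (sq_nonneg _)
      _ = _ := by ring
  refine le_of_mul_le_mul_left (key.trans_eq ?_) (pow_pos hH 2)
  ring

end IsElement

/-- Inverse estimates: on a shape regular element, the values and the gradient of the push forward
of a rational function are controlled by its `L²` norm. -/
theorem exists_inverse_estimate (S : Shape) (k n : ℕ) {σ : ℝ} (hσ : 0 < σ) :
    ∃ C, 0 < C ∧ ∀ (H : ℝ) (φ : Fin 2 → Poly) (F : Pt → Pt), IsElement S k σ H φ F →
      ∀ (q : Poly) (u : Pt → ℝ), q.totalDegree ≤ n → IsRat S φ F 4 q u → ∀ y ∈ F '' S.ref,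
        H ^ 2 * u y ^ 2 ≤ C * ∫ z in F '' S.ref, u z ^ 2 ∧
        ∀ j, H ^ 4 * pd (F '' S.ref) j u y ^ 2 ≤ C * ∫ z in F '' S.ref, u z ^ 2 := by
  obtain ⟨A, hA, hAq⟩ := S.exists_sq_le_integral n
  obtain ⟨B, hB, hBJ⟩ := S.exists_sq_le_integral (2 * k + 2 * k)
  set V := volume.real S.ref
  have hV : 0 ≤ V := measureReal_nonneg
  set K₁ := 2 * σ ^ 2 * (4 * σ ^ 4) ^ 4 with hK₁
  set K₂ := A * (32 * σ ^ 6 + 512 * σ ^ 6 * B * V) with hK₂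
  have hK₁p : 0 < K₁ := by positivity
  have hK₂p : 0 < K₂ := by positivity
  refine ⟨(2 * σ ^ 4) ^ 4 * A * K₁ + (2 * σ ^ 4) ^ 6 * K₂ * K₁, by positivity,
    fun H φ F E q u hq hu y hy => ?_⟩
  obtain ⟨x, hx, rfl⟩ := hy
  have hH := E.size_pos
  have hJ := E.jac_ne_zero hx
  set U := ∫ z in F '' S.ref, u z ^ 2
  have hU : 0 ≤ U := integral_nonneg fun _ => sq_nonneg _
  set I := ∫ x in S.ref, ev q x ^ 2
  have hI : 0 ≤ I := integral_nonneg fun _ => sq_nonneg _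
  have hIU : I ≤ K₁ * H ^ 14 * U := E.integral_sq_le hu
  obtain ⟨hq0, hq1⟩ := hAq q hq x hx
  set J := ev (jac φ) x
  have hlow : H ^ 4 ≤ 2 * σ ^ 4 * J ^ 2 := E.le_sq_jac hx
  have h1 : H ^ 2 * u (F x) ^ 2 ≤ (2 * σ ^ 4) ^ 4 * A * K₁ * U := by
    have e : ev q x ^ 2 = (J ^ 2) ^ 4 * u (F x) ^ 2 := by
      rw [hu x hx, div_pow, ← pow_mul, ← pow_mul, mul_div_cancel₀ _ (pow_ne_zero _ hJ)]
    -- Dividing `q²` by `J⁸` gains `H¹⁶`, while the norm of `q` costs `H¹⁴`; the surplus is the `H²`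
    -- of the claim. For the gradient the balance is `H²⁴` against `H⁶ H¹⁴`.
    refine le_of_mul_le_mul_left ?_ (pow_pos hH 14)
    calc H ^ 14 * (H ^ 2 * u (F x) ^ 2) = (H ^ 4) ^ 4 * u (F x) ^ 2 := by ring
      _ ≤ (2 * σ ^ 4 * J ^ 2) ^ 4 * u (F x) ^ 2 :=
          mul_le_mul_of_nonneg_right (pow_le_pow_left₀ (by positivity) hlow 4) (sq_nonneg _)
      _ = (2 * σ ^ 4) ^ 4 * ev q x ^ 2 := by rw [e]; ring
      _ ≤ (2 * σ ^ 4) ^ 4 * (A * (K₁ * H ^ 14 * U)) :=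
          mul_le_mul_of_nonneg_left (hq0.trans (mul_le_mul_of_nonneg_left hIU hA.le))
            (by positivity)
      _ = _ := by ring
  have h2 : ∀ j, H ^ 4 * pd (F '' S.ref) j u (F x) ^ 2 ≤
      (2 * σ ^ 4) ^ 6 * K₂ * K₁ * U := by
    intro j
    set N := ev (pdNum φ j 4 q) x with hN
    have e : N ^ 2 = (J ^ 2) ^ 6 * pd (F '' S.ref) j u (F x) ^ 2 := by
      rw [E.isRat_pd hu j x hx, div_pow, ← pow_mul, ← pow_mul,
        mul_div_cancel₀ _ (pow_ne_zero _ hJ)]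
    -- Shape regularity says nothing about second derivatives of `F`, which enter through the
    -- gradient of `J`. They are controlled because `J` is a bounded polynomial of degree at most
    -- `4k`.
    have hJint : ∫ z in S.ref, ev (jac φ) z ^ 2 ≤ 4 * σ ^ 4 * H ^ 4 * V := by
      have := setIntegral_mono_on (μ := volume) (f := fun z => ev (jac φ) z ^ 2)
        (g := fun _ => 4 * σ ^ 4 * H ^ 4)
        (((continuous_ev _).pow 2).continuousOn.integrableOn_compact S.isCompact_ref)
        (integrableOn_const S.volume_ref_lt_top.ne) S.isClosed_ref.measurableSet
        fun z hz => E.sq_jac_le hz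
      rwa [setIntegral_const, smul_eq_mul, mul_comm] at this
    have hN2 : N ^ 2 ≤ H ^ 6 * K₂ * I := by
      refine (E.sq_pdNum_le hx j (b := B * (4 * σ ^ 4 * V)) hq0 hq1 fun i =>
        ((hBJ (jac φ) (totalDegree_jac_le φ E.totalDegree_le) x hx).2 i).trans
          ((mul_le_mul_of_nonneg_left hJint hB.le).trans_eq (by ring))).trans_eq ?_
      rw [hK₂]
      ring
    refine le_of_mul_le_mul_left ?_ (pow_pos hH 20)
    calc H ^ 20 * (H ^ 4 * pd (F '' S.ref) j u (F x) ^ 2)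
        = (H ^ 4) ^ 6 * pd (F '' S.ref) j u (F x) ^ 2 := by ring
      _ ≤ (2 * σ ^ 4 * J ^ 2) ^ 6 * pd (F '' S.ref) j u (F x) ^ 2 :=
          mul_le_mul_of_nonneg_right (pow_le_pow_left₀ (by positivity) hlow 6) (sq_nonneg _)
      _ = (2 * σ ^ 4) ^ 6 * N ^ 2 := by rw [e]; ring
      _ ≤ (2 * σ ^ 4) ^ 6 * (H ^ 6 * K₂ * (K₁ * H ^ 14 * U)) :=
          mul_le_mul_of_nonneg_left (hN2.trans (mul_le_mul_of_nonneg_left hIU (by positivity)))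
            (by positivity)
      _ = _ := by ring
  have p1 : 0 ≤ (2 * σ ^ 4) ^ 4 * A * K₁ * U := by positivity
  have p2 : 0 ≤ (2 * σ ^ 4) ^ 6 * K₂ * K₁ * U := by positivity
  rw [add_mul]
  exact ⟨h1.trans (by linarith), fun j => (h2 j).trans (by linarith)⟩

namespace IsElement

variable {S : Shape} {k : ℕ} {σ H : ℝ} {φ : Fin 2 → Poly} {F : Pt → Pt}

/-! ### Normals -/

/-- Inversion of operators is continuous at invertible ones. This makes the edge integrands
measurable and bounded. -/
theorem continuousOn_normal (E : IsElement S k σ H φ F) {n : Pt} (hn : n ≠ 0) :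
    ContinuousOn (fun x => ‖(ContinuousLinearMap.adjoint
      (fderiv ℝ F (Function.invFunOn F S.ref x))).inverse n‖⁻¹ • (ContinuousLinearMap.adjoint
      (fderiv ℝ F (Function.invFunOn F S.ref x))).inverse n) (F '' S.ref) := by
  have key : ∀ z ∈ S.ref, ∃ e : Pt ≃L[ℝ] Pt,
      (e : Pt →L[ℝ] Pt) = ContinuousLinearMap.adjoint (fderiv ℝ F z) := by
    intro z hz
    obtain ⟨e, he⟩ := E.exists_equiv hz
    have h1 : ∀ a b : Pt →L[ℝ] Pt, a.comp b = ContinuousLinearMap.id ℝ Pt → Function.LeftInverse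
        (ContinuousLinearMap.adjoint b) (ContinuousLinearMap.adjoint a) := by
      intro a b hab v
      rw [← ContinuousLinearMap.comp_apply, ← ContinuousLinearMap.adjoint_comp, hab,
        ContinuousLinearMap.adjoint_id]
      rfl
    rw [← he]
    refine ⟨ContinuousLinearEquiv.equivOfInverse (ContinuousLinearMap.adjoint (e : Pt →L[ℝ] Pt))
      (ContinuousLinearMap.adjoint (e.symm : Pt →L[ℝ] Pt))
      (h1 _ _ e.coe_comp_coe_symm) (h1 _ _ e.coe_symm_comp_coe), ?_⟩
    ext; rfl
  have hc : ContinuousOn (fun z => (ContinuousLinearMap.adjoint (fderiv ℝ F z)).inverse n)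
      S.ref := by
    intro z hz
    obtain ⟨e, he⟩ := key z hz
    have h1 : ContinuousAt ContinuousLinearMap.inverse
        (ContinuousLinearMap.adjoint (fderiv ℝ F z)) := by
      rw [← he]
      exact (contDiffAt_map_inverse (n := 0) e).continuousAt
    have h2 : Continuous fun z => ContinuousLinearMap.adjoint (fderiv ℝ F z) :=
      ContinuousLinearMap.adjoint.continuous.comp (E.contDiff.continuous_fderiv (by simp))
    exact ((ContinuousAt.comp (f := fun z => ContinuousLinearMap.adjoint (fderiv ℝ F z)) h1
      h2.continuousAt).clm_apply continuousAt_const).continuousWithinAt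
  have hne : ∀ z ∈ S.ref, (ContinuousLinearMap.adjoint (fderiv ℝ F z)).inverse n ≠ 0 := by
    intro z hz
    obtain ⟨e, he⟩ := key z hz
    rw [← he, ContinuousLinearMap.inverse_equiv]
    simpa using hn
  have h3 := hc.comp E.continuousOn_inv fun y hy => Function.invFunOn_mem hy
  exact (h3.norm.inv₀ fun y hy => norm_ne_zero_iff.mpr (hne _ (Function.invFunOn_mem hy))).smul h3

end IsElement

namespace IsRat

variable {S : Shape} {φ : Fin 2 → Poly} {F : Pt → Pt} {m : ℕ} {q q' : Poly} {u u' : Pt → ℝ}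

theorem smul_add (hu : IsRat S φ F m q u) (hu' : IsRat S φ F m q' u') (c : ℝ) :
    IsRat S φ F m (c • q + q') (c • u + u') := fun x hx => by
  simp only [Pi.add_apply, Pi.smul_apply, smul_eq_mul, hu x hx, hu' x hx, ev_add, ev_smul]
  ring

end IsRat

namespace Mesh

variable {S : Shape} {k : ℕ} {Ω : Set Pt} (M : Mesh S k Ω)

/-! ### Elements of a mesh -/

/-- The polynomial components of the element maps. -/
def poly (T : Fin M.N) (j : Fin 2) : Poly := (M.F_poly T j).choose

theorem apply_eq_ev (T : Fin M.N) (x : Pt) (j : Fin 2) : M.F T x j = ev (M.poly T j) x :=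
  (M.F_poly T j).choose_spec.2 x

theorem continuous_F (T : Fin M.N) : Continuous (M.F T) := by
  have : ContDiff ℝ ∞ (M.F T) := by
    rw [contDiff_euclidean]
    intro j
    simp only [M.apply_eq_ev]
    exact contDiff_ev _
  exact this.continuous

theorem isCompact_elem (T : Fin M.N) : IsCompact (M.elem T) :=
  S.isCompact_ref.image (M.continuous_F T)

theorem dist_le_size (T : Fin M.N) {x y : Pt} (hx : x ∈ M.elem T) (hy : y ∈ M.elem T) :
    dist x y ≤ M.size T :=
  Metric.dist_le_diam_of_mem (M.isCompact_elem T).isBounded hx hy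

theorem size_pos (T : Fin M.N) : 0 < M.size T := by
  have h1 : (!₂[1 / 4, 1 / 4] : Pt) ∈ S.ref := S.refInterior_subset
    (S.mem_refInterior_of_mem_Ioo fun i => by fin_cases i <;> constructor <;> norm_num)
  have h2 : (!₂[1 / 8, 1 / 4] : Pt) ∈ S.ref := S.refInterior_subset
    (S.mem_refInterior_of_mem_Ioo fun i => by fin_cases i <;> constructor <;> norm_num)
  have hne : (!₂[1 / 4, 1 / 4] : Pt) ≠ !₂[1 / 8, 1 / 4] := by
    intro h
    have := congrArg (fun x : Pt => x 0) h
    norm_num at this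
  exact (dist_pos.mpr ((M.F_inj T).ne h1 h2 hne)).trans_le
    (M.dist_le_size T ⟨_, h1, rfl⟩ ⟨_, h2, rfl⟩)

variable {M} {σ : ℝ}

theorem ShapeRegular.isElement (hM : M.ShapeRegular σ) (T : Fin M.N) :
    IsElement S k σ (M.size T) (M.poly T) (M.F T) where
  totalDegree_le j := S.totalDegree_le_of_mem_polys k _ (M.F_poly T j).choose_spec.1
  apply_eq := M.apply_eq_ev T
  injOn := M.F_inj T
  size_pos := M.size_pos T
  regularity_pos := by
    obtain ⟨x, hx⟩ := S.refInterior_nonempty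
    have := (hM T x (S.refInterior_subset hx)).2 (EuclideanSpace.single 0 1)
    rw [PiLp.norm_single, norm_one, mul_one] at this
    exact pos_of_mul_pos_left ((M.size_pos T).trans_le this) (norm_nonneg _)
  norm_fderiv_le x hx := (hM T x hx).1
  le_norm_fderiv x hx := (hM T x hx).2

theorem IsDensity.pos {h : Pt → ℝ} (hh : M.IsDensity σ h) (hσ : 0 < σ) {T : Fin M.N} {x : Pt}
    (hx : x ∈ M.elem T) : 0 < h x :=
  pos_of_mul_pos_right ((M.size_pos T).trans_le (hh.2 T x hx).1) hσ.le

/-! ### Tensor fields of `ℍ_h^k` -/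

variable (M)

/-- Broken tensor fields. -/
abbrev Tensor := Fin 2 → Fin 2 → M.Broken

/-- The numerator of the second derivatives of a function of `𝕍_h^k`. -/
def hessNum (T : Fin M.N) (i j : Fin 2) : Poly →ₗ[ℝ] Poly :=
  pdNum (M.poly T) i 2 ∘ₗ pdNum (M.poly T) j 0

/-- `τ` is on every element the Hessian of the function with reference polynomial `p T`. -/
def HasCoeff (p : Fin M.N → S.polys k) (τ : M.Tensor) : Prop :=
  ∀ T i j, IsRat S (M.poly T) (M.F T) 4 (M.hessNum T i j (p T)) (τ i j T)

variable {M}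

theorem isRat_zero_iff {T : Fin M.N} {p : Poly} {u : Pt → ℝ} :
    IsRat S (M.poly T) (M.F T) 0 p u ↔
      ∀ x ∈ S.ref, u (M.F T x) = MvPolynomial.eval (fun i => x i) p := by
  simp only [IsRat, pow_zero, div_one]
  rfl

theorem ShapeRegular.totalDegree_hessNum_le (hM : M.ShapeRegular σ) (T : Fin M.N) (i j : Fin 2)
    (p : S.polys k) : (M.hessNum T i j p).totalDegree ≤ 14 * k := by
  have h := (hM.isElement T).totalDegree_le
  have h0 := S.totalDegree_le_of_mem_polys k _ p.2
  have := totalDegree_pdNum_le _ h i 2 (totalDegree_pdNum_le _ h j 0 h0)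
  refine LE.le.trans this ?_
  omega

/-- Replaces functions, of which only the values on the elements matter, by a finite-dimensional
space of coefficients on which the Hessian acts linearly. -/
theorem ShapeRegular.memHess_iff (hM : M.ShapeRegular σ) {τ : M.Tensor} :
    M.MemHess τ ↔ ∃ p, M.HasCoeff p τ := by
  constructor
  · rintro ⟨w, hw, hτ⟩
    choose p hp hwp using hw
    refine ⟨fun T => ⟨p T, hp T⟩, fun T i j => ?_⟩
    have E := hM.isElement T
    exact (E.isRat_pd (E.isRat_pd (isRat_zero_iff.mpr (hwp T)) j) i).congr
      fun y hy => hτ T y hy i j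
  · rintro ⟨p, hp⟩
    let w : M.Broken := fun T y => ev (p T) (Function.invFunOn (M.F T) S.ref y)
    have hw : ∀ T, IsRat S (M.poly T) (M.F T) 0 (p T) (w T) := fun T x hx => by
      simp only [w, (hM.isElement T).invFunOn_apply hx, pow_zero, div_one]
    refine ⟨w, fun T => ⟨p T, (p T).2, isRat_zero_iff.mp (hw T)⟩, fun T y hy i j => ?_⟩
    have E := hM.isElement T
    exact (hp T i j).eq (E.isRat_pd (E.isRat_pd (hw T) j) i) hy

theorem HasCoeff.smul_add {p p' : Fin M.N → S.polys k} {τ τ' : M.Tensor} (h : M.HasCoeff p τ)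
    (h' : M.HasCoeff p' τ') (c : ℝ) : M.HasCoeff (c • p + p') (c • τ + τ') := fun T i j => by
  have := (h T i j).smul_add (h' T i j) c
  rw [← map_smul, ← map_add] at this
  exact this

theorem hasCoeff_zero : M.HasCoeff 0 0 := fun T i j x _ => by
  have : M.hessNum T i j ((0 : Fin M.N → S.polys k) T) = 0 := map_zero _
  rw [this]
  simp

/-- The tensor field with the reference polynomials `p`. -/
def ofCoeff (p : Fin M.N → S.polys k) : M.Tensor := fun i j T y =>
  ev (M.hessNum T i j (p T)) (Function.invFunOn (M.F T) S.ref y) /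
    ev (jac (M.poly T)) (Function.invFunOn (M.F T) S.ref y) ^ 4

theorem ofCoeff_smul_add (c : ℝ) (p p' : Fin M.N → S.polys k) :
    ofCoeff (M := M) (c • p + p') = c • ofCoeff p + ofCoeff p' := by
  funext i j T y
  simp only [ofCoeff, Pi.add_apply, Pi.smul_apply, Submodule.coe_add, Submodule.coe_smul, map_add,
    map_smul, ev_add, ev_smul, smul_eq_mul]
  ring

theorem hasCoeff_ofCoeff (p : Fin M.N → S.polys k) : M.HasCoeff p (ofCoeff p) :=
  fun T i j x hx => by
    rw [ofCoeff, (M.F_inj T).leftInvOn_invFunOn hx]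

namespace MemHess

variable {τ τ' η η' : M.Tensor}

theorem smul_add (hM : M.ShapeRegular σ) (h : M.MemHess τ) (h' : M.MemHess τ') (c : ℝ) :
    M.MemHess (c • τ + τ') := by
  rw [hM.memHess_iff] at *
  obtain ⟨p, hp⟩ := h
  obtain ⟨p', hp'⟩ := h'
  exact ⟨_, hp.smul_add hp' c⟩

theorem zero (hM : M.ShapeRegular σ) : M.MemHess 0 := hM.memHess_iff.mpr ⟨0, hasCoeff_zero⟩

theorem sum (hM : M.ShapeRegular σ) {ι : Type*} (s : Finset ι) {τ : ι → M.Tensor}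
    (h : ∀ i, M.MemHess (τ i)) : M.MemHess (∑ i ∈ s, τ i) := by
  classical
  induction s using Finset.induction_on with
  | empty => exact zero hM
  | insert a s ha ih =>
    rw [Finset.sum_insert ha, ← one_smul ℝ (τ a)]
    exact smul_add hM (h a) ih 1

theorem continuousOn (hM : M.ShapeRegular σ) (h : M.MemHess τ) (i j : Fin 2) (T : Fin M.N) :
    ContinuousOn (τ i j T) (M.elem T) := by
  obtain ⟨p, hp⟩ := hM.memHess_iff.mp h
  exact (hM.isElement T).continuousOn_of_isRat (hp T i j)

theorem continuousOn_dh (hM : M.ShapeRegular σ) (h : M.MemHess τ) (l i j : Fin 2) (T : Fin M.N) :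
    ContinuousOn (M.dh l (τ i j) T) (M.elem T) := by
  obtain ⟨p, hp⟩ := hM.memHess_iff.mp h
  have E := hM.isElement T
  exact E.continuousOn_of_isRat (E.isRat_pd (hp T i j) l)

theorem continuousOn_div (hM : M.ShapeRegular σ) (h : M.MemHess τ) (i : Fin 2) (T : Fin M.N) :
    ContinuousOn (M.div τ i T) (M.elem T) := by
  have : M.div τ i T = fun x => M.dh 0 (τ i 0) T x + M.dh 1 (τ i 1) T x := by
    funext x
    simp [div, Fin.sum_univ_two]
  rw [this]
  exact (continuousOn_dh hM h 0 i 0 T).add (continuousOn_dh hM h 1 i 1 T)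

/-- Linearity of the derivative is read off from linearity of `pdNum`, also at boundary points of
the element. -/
theorem dh_smul_add (hM : M.ShapeRegular σ) (h : M.MemHess τ) (h' : M.MemHess τ') (c : ℝ)
    (l i j : Fin 2) (T : Fin M.N) {x : Pt} (hx : x ∈ M.elem T) :
    M.dh l ((c • τ + τ') i j) T x = c * M.dh l (τ i j) T x + M.dh l (τ' i j) T x := by
  obtain ⟨p, hp⟩ := hM.memHess_iff.mp h
  obtain ⟨p', hp'⟩ := hM.memHess_iff.mp h'
  have E := hM.isElement T
  have h1 := E.isRat_pd ((hp T i j).smul_add (hp' T i j) c) l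
  rw [map_add, map_smul] at h1
  exact h1.eq ((E.isRat_pd (hp T i j) l).smul_add (E.isRat_pd (hp' T i j) l) c) hx

theorem div_smul_add (hM : M.ShapeRegular σ) (h : M.MemHess τ) (h' : M.MemHess τ') (c : ℝ)
    (i : Fin 2) (T : Fin M.N) {x : Pt} (hx : x ∈ M.elem T) :
    M.div (c • τ + τ') i T x = c * M.div τ i T x + M.div τ' i T x := by
  simp only [div, Fin.sum_univ_two, Pi.add_apply _ _ T, Pi.add_apply _ _ x]
  have h0 := dh_smul_add hM h h' c 0 i 0 T hx
  have h1 := dh_smul_add hM h h' c 1 i 1 T hx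
  rw [h0, h1]
  ring

theorem integrableOn_mul (hM : M.ShapeRegular σ) (h : M.MemHess τ) (h' : M.MemHess η)
    (i j : Fin 2) (T : Fin M.N) :
    IntegrableOn (fun x => τ i j T x * η i j T x) (M.elem T) :=
  ((h.continuousOn hM i j T).mul (h'.continuousOn hM i j T)).integrableOn_compact
    (M.isCompact_elem T)

end MemHess

theorem div_eq_zero {τ : M.Tensor} {T : Fin M.N} (h : ∀ x ∈ M.elem T, ∀ i j, τ i j T x = 0)
    (i : Fin 2) {x : Pt} (hx : x ∈ M.elem T) : M.div τ i T x = 0 := by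
  have h0 : ∀ l j, M.dh l (τ i j) T x = 0 := fun l j => by
    rw [dh, pd, fderivWithin_congr (f := fun _ => (0 : ℝ)) (fun y hy => h y hy i j) (h x hx i j)]
    simp
  simp [div, h0]

/-! ### The inner product on one element -/

variable (M)

/-- The inner product of two tensor fields on one element. -/
def elemIp (T : Fin M.N) (τ η : M.Tensor) : ℝ :=
  ∫ x in M.elem T, ∑ i, ∑ j, τ i j T x * η i j T x

variable {M}

theorem elemIp_comm (T : Fin M.N) (τ η : M.Tensor) : M.elemIp T τ η = M.elemIp T η τ := by
  simp only [elemIp, mul_comm]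

theorem elemIp_congr {T : Fin M.N} {τ τ' η η' : M.Tensor}
    (h : ∀ x ∈ M.elem T, ∀ i j, τ i j T x = τ' i j T x)
    (h' : ∀ x ∈ M.elem T, ∀ i j, η i j T x = η' i j T x) :
    M.elemIp T τ η = M.elemIp T τ' η' :=
  setIntegral_congr_fun (M.isCompact_elem T).measurableSet fun x hx => by
    simp only [h x hx, h' x hx]

theorem MemHess.elemIp_eq (hM : M.ShapeRegular σ) {τ η : M.Tensor} (h : M.MemHess τ)
    (h' : M.MemHess η) (T : Fin M.N) :
    M.elemIp T τ η = ∑ i, ∑ j, ∫ x in M.elem T, τ i j T x * η i j T x := by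
  rw [elemIp, integral_finsetSum _ fun i _ => integrable_finsetSum _ fun j _ =>
    h.integrableOn_mul hM h' i j T]
  exact Finset.sum_congr rfl fun i _ => integral_finsetSum _ fun j _ =>
    h.integrableOn_mul hM h' i j T

theorem MemHess.elemIp_smul_add (hM : M.ShapeRegular σ) {τ τ' η : M.Tensor} (h : M.MemHess τ)
    (h' : M.MemHess τ') (hη : M.MemHess η) (c : ℝ) (T : Fin M.N) :
    M.elemIp T (c • τ + τ') η = c * M.elemIp T τ η + M.elemIp T τ' η := by
  rw [(smul_add hM h h' c).elemIp_eq hM hη, h.elemIp_eq hM hη, h'.elemIp_eq hM hη, Finset.mul_sum,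
    ← Finset.sum_add_distrib]
  refine Finset.sum_congr rfl fun i _ => ?_
  rw [Finset.mul_sum, ← Finset.sum_add_distrib]
  refine Finset.sum_congr rfl fun j _ => ?_
  rw [← integral_const_mul, ← integral_add ((h.integrableOn_mul hM hη i j T).const_mul c)
    (h'.integrableOn_mul hM hη i j T)]
  refine integral_congr_ae (ae_of_all _ fun x => ?_)
  simp only [Pi.add_apply, Pi.smul_apply, smul_eq_mul]
  ring

theorem elemIp_self_nonneg (T : Fin M.N) (τ : M.Tensor) : 0 ≤ M.elemIp T τ τ :=
  integral_nonneg fun _ => Finset.sum_nonneg fun _ _ => Finset.sum_nonneg fun _ _ =>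
    mul_self_nonneg _

/-- The inverse estimates for tensor fields of `ℍ_h^k`. -/
theorem exists_tensor_inverse_estimate (S : Shape) (k : ℕ) {σ : ℝ} (hσ : 0 < σ) :
    ∃ C, 0 < C ∧ ∀ {Ω : Set Pt} (M : Mesh S k Ω), M.ShapeRegular σ → ∀ τ : M.Tensor,
      M.MemHess τ → ∀ T, ∀ x ∈ M.elem T,
        M.size T ^ 2 * ∑ i, ∑ j, τ i j T x ^ 2 ≤ C * M.elemIp T τ τ ∧
        M.size T ^ 4 * ∑ i, M.div τ i T x ^ 2 ≤ 2 * (C * M.elemIp T τ τ) := by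
  obtain ⟨C, hC, h⟩ := exists_inverse_estimate S k (14 * k) hσ
  refine ⟨C, hC, fun M hM τ hτ T x hx => ?_⟩
  obtain ⟨p, hp⟩ := hM.memHess_iff.mp hτ
  have key := fun i j => h _ _ _ (hM.isElement T) _ _ (hM.totalDegree_hessNum_le T i j (p T))
    (hp T i j) x hx
  have e : M.elemIp T τ τ = ∑ i, ∑ j, ∫ x in M.F T '' S.ref, τ i j T x ^ 2 := by
    rw [hτ.elemIp_eq hM hτ]
    simp only [sq]
    rfl
  have k1 : ∀ i j l, M.size T ^ 4 * M.dh l (τ i j) T x ^ 2 ≤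
      C * ∫ x in M.F T '' S.ref, τ i j T x ^ 2 := fun i j l => (key i j).2 l
  rw [e]
  simp only [Fin.sum_univ_two, div, Pi.add_apply _ _ T, Pi.add_apply _ _ x]
  constructor
  · linarith [(key 0 0).1, (key 0 1).1, (key 1 0).1, (key 1 1).1]
  · have k2 : ∀ a b : ℝ, M.size T ^ 4 * (a + b) ^ 2 ≤
        2 * (M.size T ^ 4 * a ^ 2) + 2 * (M.size T ^ 4 * b ^ 2) := fun a b => by
      have := mul_nonneg (pow_nonneg (M.size_pos T).le 4) (sq_nonneg (a - b))
      linarith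
    linarith [k1 0 0 0, k1 0 1 1, k1 1 0 0, k1 1 1 1, k2 (M.dh 0 (τ 0 0) T x) (M.dh 1 (τ 0 1) T x),
      k2 (M.dh 0 (τ 1 0) T x) (M.dh 1 (τ 1 1) T x)]

/-- The inverse estimate bounds point values by the norm, so a null field vanishes everywhere on the
element. -/
theorem MemHess.eq_zero_of_elemIp_self (hM : M.ShapeRegular σ) {τ : M.Tensor} (hτ : M.MemHess τ)
    {T : Fin M.N} (h : M.elemIp T τ τ = 0) {x : Pt} (hx : x ∈ M.elem T) (i j : Fin 2) :
    τ i j T x = 0 := by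
  obtain ⟨C, -, hC⟩ := exists_tensor_inverse_estimate S k (hM.isElement T).regularity_pos
  have h1 := (hC M hM τ hτ T x hx).1
  rw [h, mul_zero] at h1
  have h2 : ∑ i, ∑ j, τ i j T x ^ 2 ≤ 0 := by
    by_contra hc
    push Not at hc
    exact absurd h1 (not_le.mpr (mul_pos (pow_pos (M.size_pos T) 2) hc))
  have h3 : τ i j T x ^ 2 ≤ ∑ i, ∑ j, τ i j T x ^ 2 :=
    (Finset.single_le_sum (f := fun j => τ i j T x ^ 2) (fun _ _ => sq_nonneg _)
      (Finset.mem_univ j)).trans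
      (Finset.single_le_sum (f := fun i => ∑ j, τ i j T x ^ 2)
        (fun _ _ => Finset.sum_nonneg fun _ _ => sq_nonneg _) (Finset.mem_univ i))
  exact pow_eq_zero_iff two_ne_zero |>.mp (le_antisymm (h3.trans h2) (sq_nonneg _))

/-! ### Existence of liftings -/

/-- A linear functional on `ℍ_h^k` that depends only on the values on the patch has a lifting. -/
theorem exists_isLift (hM : M.ShapeRegular σ) (e : M.EdgeIdx) (l : M.Tensor → ℝ)
    (hl : ∀ (c : ℝ) (η η' : M.Tensor), M.MemHess η → M.MemHess η' →
      l (c • η + η') = c * l η + l η')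
    (hl0 : ∀ η : M.Tensor, M.MemHess η →
      (∀ T ∈ M.patch e, ∀ x ∈ M.elem T, ∀ i j, η i j T x = 0) → l η = 0) :
    ∃ τ, M.IsLift e l τ := by
  classical
  let W := Fin M.N → S.polys k
  have hH : ∀ p : W, M.MemHess (ofCoeff p) := fun p => hM.memHess_iff.mpr ⟨p, hasCoeff_ofCoeff p⟩
  have hadd : ∀ p p' : W, ofCoeff (M := M) (p + p') = (1 : ℝ) • ofCoeff p + ofCoeff p' :=
    fun p p' => by rw [← ofCoeff_smul_add, one_smul]
  have h0 : ofCoeff (M := M) (0 : W) = 0 := by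
    have := ofCoeff_smul_add (M := M) (-1) (0 : W) 0
    simpa using this
  have hsmul : ∀ (c : ℝ) (p : W), ofCoeff (M := M) (c • p) = c • ofCoeff p + 0 := fun c p => by
    rw [← h0, ← ofCoeff_smul_add, add_zero]
  have hz := MemHess.zero hM
  have hip0 : ∀ T (η : M.Tensor), M.elemIp T 0 η = 0 := fun T η => by simp [elemIp]
  let b : W → W → ℝ := fun p q => ∑ T ∈ M.patch e, M.elemIp T (ofCoeff p) (ofCoeff q)
  have hsymm : ∀ p q, b p q = b q p := fun p q =>
    Finset.sum_congr rfl fun T _ => elemIp_comm T _ _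
  have hbadd : ∀ p p' q, b (p + p') q = b p q + b p' q := fun p p' q => by
    simp only [b, ← Finset.sum_add_distrib]
    refine Finset.sum_congr rfl fun T _ => ?_
    rw [hadd, (hH p).elemIp_smul_add hM (hH p') (hH q), one_mul]
  have hbsmul : ∀ (c : ℝ) p q, b (c • p) q = c • b p q := fun c p q => by
    simp only [b, smul_eq_mul, Finset.mul_sum]
    refine Finset.sum_congr rfl fun T _ => ?_
    rw [hsmul, (hH p).elemIp_smul_add hM hz (hH q), hip0, add_zero]
  let B : W →ₗ[ℝ] W →ₗ[ℝ] ℝ := LinearMap.mk₂ ℝ b hbadd hbsmul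
    (fun p q q' => by rw [hsymm, hbadd, hsymm q, hsymm q'])
    (fun c p q => by rw [hsymm, hbsmul, hsymm q])
  have hlz : l 0 = 0 := hl0 0 hz fun _ _ _ _ _ _ => rfl
  let L : W →ₗ[ℝ] ℝ :=
    { toFun p := l (ofCoeff p)
      map_add' p p' := by rw [hadd, hl _ _ _ (hH p) (hH p'), one_mul]
      map_smul' c p := by rw [hsmul, hl _ _ _ (hH p) hz, hlz, add_zero]; rfl }
  -- The form is only semidefinite: coefficients off the patch and functions affine on each patch
  -- element are in its kernel. There the field vanishes on the patch, and so does `l`.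
  obtain ⟨p, hp⟩ := exists_represents B hsymm L fun p hpp => by
    refine hl0 _ (hH p) fun T hT x hx i j => ?_
    have hpp' : b p p = 0 := hpp
    have := (Finset.sum_eq_zero_iff_of_nonneg fun T _ => elemIp_self_nonneg T (ofCoeff p)).mp
      hpp' T hT
    exact (hH p).eq_zero_of_elemIp_self hM this hx i j
  -- Extension by zero stays in `ℍ_h^k`, as the zero polynomial may be chosen on the other elements.
  refine ⟨fun i j T => if T ∈ M.patch e then ofCoeff p i j T else 0, ?_, fun T hT i j => if_neg hT,
    fun η hη => ?_⟩
  · refine hM.memHess_iff.mpr ⟨fun T => if T ∈ M.patch e then p T else 0, fun T i j => ?_⟩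
    by_cases hT : T ∈ M.patch e
    · simp only [hT, if_true]
      exact hasCoeff_ofCoeff p T i j
    · simp only [hT, if_false]
      exact hasCoeff_zero T i j
  · obtain ⟨q, hq⟩ := hM.memHess_iff.mp hη
    have heq : ∀ T, ∀ x ∈ M.elem T, ∀ i j, η i j T x = ofCoeff q i j T x := fun T x hx i j =>
      (hq T i j).eq (hasCoeff_ofCoeff q T i j) hx
    -- `η` and its coefficient model may differ off the elements; their difference vanishes on the
    -- patch, so `l` cannot see it.
    have h1 : l η = l (ofCoeff q) := by
      have h2 := hl (-1) _ _ (hH q) hη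
      rw [hl0 _ (MemHess.smul_add hM (hH q) hη (-1)) fun T _ x hx i j => by
        simp [heq T x hx i j]] at h2
      linarith
    rw [h1]
    have h3 : l (ofCoeff q) = b p q := (hp q).symm
    rw [h3]
    refine Finset.sum_congr rfl fun T hT => ?_
    exact elemIp_congr (τ := fun i j T => if T ∈ M.patch e then ofCoeff p i j T else 0)
      (fun x _ i j => by rw [if_pos hT]) (heq T)

end Mesh

/-- `f` is continuous and bounded on `s`. -/
def BddContOn (s : Set Pt) (f : Pt → ℝ) : Prop := ContinuousOn f s ∧ ∃ c, ∀ x ∈ s, |f x| ≤ c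

/-! ### Bounded continuous integrands -/

namespace BddContOn

variable {s t : Set Pt} {f g : Pt → ℝ}

theorem mono (hf : BddContOn t f) (h : s ⊆ t) : BddContOn s f :=
  ⟨hf.1.mono h, hf.2.imp fun _ hc x hx => hc x (h hx)⟩

theorem of_isCompact (ht : IsCompact t) (hf : ContinuousOn f t) (h : s ⊆ t) : BddContOn s f :=
  mono ⟨hf, ht.exists_bound_of_continuousOn hf⟩ h

theorem add (hf : BddContOn s f) (hg : BddContOn s g) : BddContOn s fun x => f x + g x := by
  obtain ⟨hf, c, hc⟩ := hf
  obtain ⟨hg, d, hd⟩ := hg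
  exact ⟨hf.add hg, c + d, fun x hx => (abs_add_le _ _).trans (add_le_add (hc x hx) (hd x hx))⟩

theorem mul (hf : BddContOn s f) (hg : BddContOn s g) : BddContOn s fun x => f x * g x := by
  obtain ⟨hf, c, hc⟩ := hf
  obtain ⟨hg, d, hd⟩ := hg
  refine ⟨hf.mul hg, c * d, fun x hx => ?_⟩
  rw [abs_mul]
  exact mul_le_mul (hc x hx) (hd x hx) (abs_nonneg _) ((abs_nonneg _).trans (hc x hx))

theorem const_mul (hf : BddContOn s f) (c : ℝ) : BddContOn s fun x => c * f x :=
  mul ⟨continuousOn_const, |c|, fun _ _ => le_rfl⟩ hf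

theorem memLp (hf : BddContOn s f) (hs : MeasurableSet s) {μ : Measure Pt} (hμ : μ s < ⊤) :
    MemLp f 2 (μ.restrict s) := by
  obtain ⟨hf, c, hc⟩ := hf
  have : IsFiniteMeasure (μ.restrict s) := ⟨by rwa [Measure.restrict_apply_univ]⟩
  exact MemLp.of_bound (hf.aestronglyMeasurable hs) c
    ((ae_restrict_iff' hs).mpr (ae_of_all _ hc))

end BddContOn

theorem Shape.normal_ne_zero (S : Shape) (a : Fin S.sides) : S.normal a ≠ 0 := by
  intro h
  have h0 := congrArg (fun x : Pt => x 0) h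
  have h1 := congrArg (fun x : Pt => x 1) h
  cases S <;> fin_cases a <;> simp [Shape.normal] at h0 h1

/-- The total length of the sides of the reference element. -/
def Shape.perimeter (S : Shape) : ℝ := ∑ a, (μH[1]).real (S.refSide a)

namespace Mesh

variable {S : Shape} {k : ℕ} {Ω : Set Pt} {M : Mesh S k Ω} {σ : ℝ} {ΓD : Set Pt}

/-! ### Geometry of edges -/

theorem edge_subset_sideSet {e : M.EdgeIdx} {T : Fin M.N} (hT : T ∈ M.patch e) :
    ∃ a, M.edge ΓD e ⊆ M.sideSet (T, a) := by
  obtain ⟨s, _ | s'⟩ := e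
  · simp only [patch, Finset.mem_singleton] at hT
    subst hT
    exact ⟨s.2, fun x hx => hx.1.1⟩
  · simp only [patch, Finset.mem_insert, Finset.mem_singleton] at hT
    rcases hT with rfl | rfl
    · exact ⟨s.2, fun x hx => hx.2.1.1⟩
    · exact ⟨s'.2, fun x hx => hx.2.1.2⟩

theorem edge_subset_elem {e : M.EdgeIdx} {T : Fin M.N} (hT : T ∈ M.patch e) :
    M.edge ΓD e ⊆ M.elem T := by
  obtain ⟨a, ha⟩ := edge_subset_sideSet (ΓD := ΓD) hT
  exact ha.trans (Set.image_mono (S.refSide_subset a))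

theorem fst_mem_patch (e : M.EdgeIdx) : e.1.1 ∈ M.patch e := by
  obtain ⟨s, _ | s'⟩ := e <;> simp [patch]

theorem ShapeRegular.measurableSet_sideSet (hM : M.ShapeRegular σ) (s : M.Side) :
    MeasurableSet (M.sideSet s) :=
  (hM.isElement s.1).measurableSet_image (S.measurableSet_refSide s.2) (S.refSide_subset s.2)

theorem ShapeRegular.measurableSet_edge (hM : M.ShapeRegular σ) (hΩ : IsOpen Ω) (e : M.EdgeIdx) :
    MeasurableSet (M.edge ΓD e) := by
  obtain ⟨s, _ | s'⟩ := e
  · exact ((hM.measurableSet_sideSet s).inter isClosed_frontier.measurableSet).inter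
      (MeasurableSet.const _)
  · exact (MeasurableSet.const _).inter (((hM.measurableSet_sideSet s).inter
      (hM.measurableSet_sideSet s')).inter hΩ.measurableSet)

theorem ShapeRegular.hausdorffMeasure_edge_le (hM : M.ShapeRegular σ) {e : M.EdgeIdx}
    {T : Fin M.N} (hT : T ∈ M.patch e) :
    (μH[1]) (M.edge ΓD e) < ⊤ ∧ (μH[1]).real (M.edge ΓD e) ≤ σ * M.size T * S.perimeter := by
  obtain ⟨a, ha⟩ := edge_subset_sideSet (ΓD := ΓD) hT
  have E := hM.isElement T
  have h1 := (measure_mono ha).trans (E.hausdorffMeasure_image_le (S.refSide_subset a))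
  have h2 : ENNReal.ofReal (σ * M.size T) * μH[1] (S.refSide a) < ⊤ :=
    ENNReal.mul_lt_top ENNReal.ofReal_lt_top (S.hausdorffMeasure_refSide_lt_top a)
  have h0 : 0 ≤ σ * M.size T := mul_nonneg E.regularity_pos.le E.size_pos.le
  refine ⟨h1.trans_lt h2, (ENNReal.toReal_mono h2.ne h1).trans ?_⟩
  rw [ENNReal.toReal_mul, ENNReal.toReal_ofReal h0]
  exact mul_le_mul_of_nonneg_left (Finset.single_le_sum
    (f := fun a => (μH[1]).real (S.refSide a)) (fun _ _ => measureReal_nonneg)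
    (Finset.mem_univ a)) h0

theorem ShapeRegular.hausdorffMeasure_edge_lt_top (hM : M.ShapeRegular σ) (e : M.EdgeIdx) :
    (μH[1]) (M.edge ΓD e) < ⊤ :=
  (hM.hausdorffMeasure_edge_le (fst_mem_patch e)).1

/-- An inequality suffices for the estimates and also covers a vanishing unnormalized vector. -/
theorem norm_edgeNormal_le (e : M.EdgeIdx) (x : Pt) : ‖M.edgeNormal e x‖ ≤ 1 := by
  simp only [edgeNormal, outNormal, norm_smul, norm_inv, norm_norm]
  exact inv_mul_le_one

theorem sq_add_sq_edgeNormal_le (e : M.EdgeIdx) (x : Pt) :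
    M.edgeNormal e x 0 ^ 2 + M.edgeNormal e x 1 ^ 2 ≤ 1 := by
  have h := pow_le_pow_left₀ (norm_nonneg _) (norm_edgeNormal_le e x) 2
  rw [EuclideanSpace.norm_sq_eq, Fin.sum_univ_two] at h
  simpa using h

theorem ShapeRegular.bddContOn_edgeNormal (hM : M.ShapeRegular σ) (e : M.EdgeIdx) (i : Fin 2) :
    BddContOn (M.edge ΓD e) fun x => M.edgeNormal e x i := by
  have h := (hM.isElement e.1.1).continuousOn_normal (S.normal_ne_zero e.1.2)
  exact BddContOn.of_isCompact (M.isCompact_elem e.1.1)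
    ((EuclideanSpace.proj i : Pt →L[ℝ] ℝ).continuous.comp_continuousOn h)
    (edge_subset_elem (fst_mem_patch e))

/-! ### Averages and jumps -/

theorem avg_smul_add (u v : M.Broken) (c : ℝ) (e : M.EdgeIdx) (x : Pt) :
    M.avg (c • u + v) e x = c * M.avg u e x + M.avg v e x := by
  obtain ⟨s, _ | s'⟩ := e
  · rfl
  · simp only [avg, Pi.add_apply, Pi.smul_apply, smul_eq_mul]
    ring

theorem avg_congr {u v : M.Broken} {e : M.EdgeIdx} {x : Pt}
    (h : ∀ T ∈ M.patch e, u T x = v T x) : M.avg u e x = M.avg v e x := by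
  obtain ⟨s, _ | s'⟩ := e
  · exact h _ (by simp [patch])
  · simp only [avg]
    rw [h s.1 (by simp [patch]), h s'.1 (by simp [patch])]

theorem avg_eq_zero {u : M.Broken} {e : M.EdgeIdx} {x : Pt} (h : ∀ T ∈ M.patch e, u T x = 0) :
    M.avg u e x = 0 := by
  rw [avg_congr (v := 0) h]
  obtain ⟨s, _ | s'⟩ := e <;> simp [avg]

theorem sq_avg_le (u : M.Broken) (e : M.EdgeIdx) (x : Pt) :
    M.avg u e x ^ 2 ≤ ∑ T ∈ M.patch e, u T x ^ 2 := by
  obtain ⟨s, _ | s'⟩ := e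
  · simp [avg, patch]
  · simp only [avg, patch]
    -- Such an index has an empty edge, but its patch collapses to one element and the pointwise
    -- bound still has to be checked.
    by_cases h : s.1 = s'.1
    · rw [h, Finset.pair_eq_singleton, Finset.sum_singleton]
      apply le_of_eq
      ring
    · rw [Finset.sum_pair h]
      linarith [sq_nonneg (u s.1 x - u s'.1 x), sq_nonneg (u s.1 x), sq_nonneg (u s'.1 x)]

theorem bddContOn_avg {u : M.Broken} (hu : ∀ T, ContinuousOn (u T) (M.elem T)) (e : M.EdgeIdx) :
    BddContOn (M.edge ΓD e) (M.avg u e) := by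
  have h : ∀ T ∈ M.patch e, BddContOn (M.edge ΓD e) (u T) := fun T hT =>
    BddContOn.of_isCompact (M.isCompact_elem T) (hu T) (edge_subset_elem hT)
  obtain ⟨s, _ | s'⟩ := e
  · exact h _ (by simp [patch])
  · have := ((h s.1 (by simp [patch])).add (h s'.1 (by simp [patch]))).const_mul (2⁻¹)
    simpa only [avg, inv_mul_eq_div] using this

/-- Square integrability is built into `IsTrace`, and the default value is zero, so no trace theorem
is required to integrate the jumps. -/
theorem memLp_trace (U s : Set Pt) (u : Pt → ℝ) : MemLp (trace U s u) 2 ((μH[1]).restrict s) := by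
  rw [trace]
  split_ifs with h
  · exact h.choose_spec.1
  · exact MemLp.zero

theorem ShapeRegular.memLp_jump (hM : M.ShapeRegular σ) (hΩ : IsOpen Ω) {u : M.Broken}
    (hu : ∀ T, ContinuousOn (u T) (M.elem T)) (d : Pt → ℝ) (e : M.EdgeIdx) :
    MemLp (M.jump ΓD d u e) 2 ((μH[1]).restrict (M.edge ΓD e)) := by
  have h : ∀ T ∈ M.patch e, MemLp (u T) 2 ((μH[1]).restrict (M.edge ΓD e)) := fun T hT =>
    (BddContOn.of_isCompact (M.isCompact_elem T) (hu T) (edge_subset_elem hT)).memLp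
      (hM.measurableSet_edge hΩ e) (hM.hausdorffMeasure_edge_lt_top e)
  obtain ⟨s, _ | s'⟩ := e
  · exact (h s.1 (by simp [patch])).sub (memLp_trace _ _ _)
  · exact (h s.1 (by simp [patch])).sub (h s'.1 (by simp [patch]))

/-! ### Edge functionals -/

/-- The `i`-th component of `{τ} μ`. -/
def normalAvg (τ : M.Tensor) (e : M.EdgeIdx) (i : Fin 2) (x : Pt) : ℝ :=
  ∑ j, M.avg (τ i j) e x * M.edgeNormal e x j

/-- `{div τ} · μ`. -/
def normalAvgDiv (τ : M.Tensor) (e : M.EdgeIdx) (x : Pt) : ℝ :=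
  ∑ i, M.avg (M.div τ i) e x * M.edgeNormal e x i

/-- The functional that defines `r_e`. -/
def edgeR (ΓD : Set Pt) (e : M.EdgeIdx) (φ : Fin 2 → Pt → ℝ) (η : M.Tensor) : ℝ :=
  ∫ x in M.edge ΓD e, ∑ i, φ i x * normalAvg η e i x ∂μH[1]

/-- The functional that defines `b_e`. -/
def edgeB (ΓD : Set Pt) (e : M.EdgeIdx) (φ : Pt → ℝ) (η : M.Tensor) : ℝ :=
  ∫ x in M.edge ΓD e, φ x * normalAvgDiv η e x ∂μH[1]

theorem sq_sum_mul_edgeNormal_le (a : Fin 2 → ℝ) (e : M.EdgeIdx) (x : Pt) :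
    (∑ j, a j * M.edgeNormal e x j) ^ 2 ≤ ∑ j, a j ^ 2 := by
  have h := sq_add_sq_edgeNormal_le e x
  simp only [Fin.sum_univ_two]
  nlinarith [sq_nonneg (a 0 * M.edgeNormal e x 1 - a 1 * M.edgeNormal e x 0),
    mul_le_mul_of_nonneg_left h (add_nonneg (sq_nonneg (a 0)) (sq_nonneg (a 1)))]

theorem sum_sq_normalAvg_le (τ : M.Tensor) (e : M.EdgeIdx) (x : Pt) :
    ∑ i, normalAvg τ e i x ^ 2 ≤ ∑ T ∈ M.patch e, ∑ i, ∑ j, τ i j T x ^ 2 := by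
  rw [Finset.sum_comm]
  refine Finset.sum_le_sum fun i _ => (sq_sum_mul_edgeNormal_le _ e x).trans ?_
  rw [Finset.sum_comm]
  exact Finset.sum_le_sum fun j _ => sq_avg_le _ e x

theorem sq_normalAvgDiv_le (τ : M.Tensor) (e : M.EdgeIdx) (x : Pt) :
    normalAvgDiv τ e x ^ 2 ≤ ∑ T ∈ M.patch e, ∑ i, M.div τ i T x ^ 2 := by
  refine (sq_sum_mul_edgeNormal_le _ e x).trans ?_
  rw [Finset.sum_comm]
  exact Finset.sum_le_sum fun j _ => sq_avg_le _ e x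

theorem MemHess.memLp_normalAvg (hM : M.ShapeRegular σ) (hΩ : IsOpen Ω) {τ : M.Tensor}
    (hτ : M.MemHess τ) (e : M.EdgeIdx) (i : Fin 2) :
    MemLp (normalAvg τ e i) 2 ((μH[1]).restrict (M.edge ΓD e)) := by
  have h := fun j => (bddContOn_avg (ΓD := ΓD) (hτ.continuousOn hM i j) e).mul
    (hM.bddContOn_edgeNormal e j)
  have := ((h 0).add (h 1)).memLp (hM.measurableSet_edge hΩ e) (hM.hausdorffMeasure_edge_lt_top e)
  have he : normalAvg τ e i = _ := funext fun x => Fin.sum_univ_two _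
  rwa [he]

theorem MemHess.memLp_normalAvgDiv (hM : M.ShapeRegular σ) (hΩ : IsOpen Ω) {τ : M.Tensor}
    (hτ : M.MemHess τ) (e : M.EdgeIdx) :
    MemLp (normalAvgDiv τ e) 2 ((μH[1]).restrict (M.edge ΓD e)) := by
  have h := fun i => (bddContOn_avg (ΓD := ΓD) (hτ.continuousOn_div hM i) e).mul
    (hM.bddContOn_edgeNormal e i)
  have := ((h 0).add (h 1)).memLp (hM.measurableSet_edge hΩ e) (hM.hausdorffMeasure_edge_lt_top e)
  have he : normalAvgDiv τ e = _ := funext fun x => Fin.sum_univ_two _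
  rwa [he]

theorem normalAvg_smul_add (τ τ' : M.Tensor) (c : ℝ) (e : M.EdgeIdx) (i : Fin 2) (x : Pt) :
    normalAvg (c • τ + τ') e i x = c * normalAvg τ e i x + normalAvg τ' e i x := by
  have h : ∀ j, M.avg ((c • τ + τ') i j) e x = c * M.avg (τ i j) e x + M.avg (τ' i j) e x :=
    fun j => avg_smul_add _ _ c e x
  simp only [normalAvg, Fin.sum_univ_two, h]
  ring

theorem MemHess.normalAvgDiv_smul_add (hM : M.ShapeRegular σ) {τ τ' : M.Tensor}
    (hτ : M.MemHess τ) (hτ' : M.MemHess τ') (c : ℝ) {e : M.EdgeIdx} {x : Pt}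
    (hx : x ∈ M.edge ΓD e) :
    normalAvgDiv (c • τ + τ') e x = c * normalAvgDiv τ e x + normalAvgDiv τ' e x := by
  have h : ∀ i, M.avg (M.div (c • τ + τ') i) e x =
      c * M.avg (M.div τ i) e x + M.avg (M.div τ' i) e x := fun i => by
    rw [← avg_smul_add]
    exact avg_congr fun T hT => hτ.div_smul_add hM hτ' c i T (edge_subset_elem hT hx)
  simp only [normalAvgDiv, Fin.sum_univ_two, h]
  ring

variable {e : M.EdgeIdx} {φ : Fin 2 → Pt → ℝ} {ψ : Pt → ℝ}

theorem exists_isLift_edgeR (hM : M.ShapeRegular σ) (hΩ : IsOpen Ω)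
    (hφ : ∀ i, MemLp (φ i) 2 ((μH[1]).restrict (M.edge ΓD e))) :
    ∃ τ, M.IsLift e (edgeR ΓD e φ) τ := by
  refine exists_isLift hM e _ (fun c η η' hη hη' => ?_) fun η _ h => ?_
  · have int : ∀ τ : M.Tensor, M.MemHess τ → Integrable (fun x => ∑ i, φ i x * normalAvg τ e i x)
        ((μH[1]).restrict (M.edge ΓD e)) := fun τ hτ =>
      integrable_finsetSum _ fun i _ => (hφ i).integrable_mul (hτ.memLp_normalAvg hM hΩ e i)
    rw [edgeR, edgeR, edgeR, ← integral_const_mul, ← integral_add ((int η hη).const_mul c)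
      (int η' hη')]
    refine integral_congr_ae (ae_of_all _ fun x => ?_)
    simp only [normalAvg_smul_add, Fin.sum_univ_two]
    ring
  · rw [edgeR, setIntegral_congr_fun (g := fun _ => 0) (hM.measurableSet_edge hΩ e), integral_zero]
    intro x hx
    have h0 : ∀ i j, M.avg (η i j) e x = 0 := fun i j =>
      avg_eq_zero fun T hT => h T hT x (edge_subset_elem hT hx) i j
    simp [normalAvg, h0]

theorem exists_isLift_edgeB (hM : M.ShapeRegular σ) (hΩ : IsOpen Ω)
    (hψ : MemLp ψ 2 ((μH[1]).restrict (M.edge ΓD e))) :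
    ∃ τ, M.IsLift e (edgeB ΓD e ψ) τ := by
  refine exists_isLift hM e _ (fun c η η' hη hη' => ?_) fun η _ h => ?_
  · have int : ∀ τ : M.Tensor, M.MemHess τ → Integrable (fun x => ψ x * normalAvgDiv τ e x)
        ((μH[1]).restrict (M.edge ΓD e)) := fun τ hτ =>
      hψ.integrable_mul (hτ.memLp_normalAvgDiv hM hΩ e)
    rw [edgeB, edgeB, edgeB, ← integral_const_mul, ← integral_add ((int η hη).const_mul c)
      (int η' hη')]
    refine setIntegral_congr_fun (hM.measurableSet_edge hΩ e) fun x hx => ?_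
    simp only [hη.normalAvgDiv_smul_add hM hη' c hx]
    ring
  · rw [edgeB, setIntegral_congr_fun (g := fun _ => 0) (hM.measurableSet_edge hΩ e), integral_zero]
    intro x hx
    have h0 : ∀ i, M.avg (M.div η i) e x = 0 := fun i =>
      avg_eq_zero fun T hT => div_eq_zero (h T hT) i (edge_subset_elem hT hx)
    simp [normalAvgDiv, h0]

theorem isLift_liftR (hM : M.ShapeRegular σ) (hΩ : IsOpen Ω)
    (hφ : ∀ i, MemLp (φ i) 2 ((μH[1]).restrict (M.edge ΓD e))) :
    M.IsLift e (edgeR ΓD e φ) (M.liftR ΓD e φ) := by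
  have h := exists_isLift_edgeR hM hΩ hφ
  change M.IsLift e (edgeR ΓD e φ) (M.lift e (edgeR ΓD e φ))
  rw [lift, dif_pos h]
  exact h.choose_spec

theorem isLift_liftB (hM : M.ShapeRegular σ) (hΩ : IsOpen Ω)
    (hψ : MemLp ψ 2 ((μH[1]).restrict (M.edge ΓD e))) :
    M.IsLift e (edgeB ΓD e ψ) (M.liftB ΓD e ψ) := by
  have h := exists_isLift_edgeB hM hΩ hψ
  change M.IsLift e (edgeB ΓD e ψ) (M.lift e (edgeB ΓD e ψ))
  rw [lift, dif_pos h]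
  exact h.choose_spec

/-- The lifting functionals of one edge are controlled by the weighted norms of the jumps and the
norm on the patch. -/
theorem edgeB_sub_edgeR_le (hM : M.ShapeRegular σ) (hΩ : IsOpen Ω) {h : Pt → ℝ}
    (hh : M.IsDensity σ h) {C : ℝ} (hC : 0 < C)
    (hinv : ∀ τ : M.Tensor, M.MemHess τ → ∀ T, ∀ x ∈ M.elem T,
      M.size T ^ 2 * ∑ i, ∑ j, τ i j T x ^ 2 ≤ C * M.elemIp T τ τ ∧
      M.size T ^ 4 * ∑ i, M.div τ i T x ^ 2 ≤ 2 * (C * M.elemIp T τ τ))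
    (hφ : ∀ i, MemLp (φ i) 2 ((μH[1]).restrict (M.edge ΓD e)))
    (hψ : MemLp ψ 2 ((μH[1]).restrict (M.edge ΓD e)))
    {η : M.Tensor} (hη : M.MemHess η) {A : ℝ} (hA : 0 < A) :
    edgeB ΓD e ψ η - edgeR ΓD e φ η ≤
      A / 2 * (∑ i, ∫ x in M.edge ΓD e, (h x)⁻¹ * φ i x * φ i x ∂μH[1] +
        ∫ x in M.edge ΓD e, (h x ^ 3)⁻¹ * ψ x * ψ x ∂μH[1]) +
      (2 * A)⁻¹ * ((σ * C + 2 * σ ^ 3 * C) * (σ * S.perimeter) *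
        ∑ T ∈ M.patch e, M.elemIp T η η) := by
  set μ := (μH[1] : Measure Pt).restrict (M.edge ΓD e) with hμ
  have hme := hM.measurableSet_edge (ΓD := ΓD) hΩ e
  have : IsFiniteMeasure μ :=
    ⟨by rw [hμ, Measure.restrict_apply_univ]; exact hM.hausdorffMeasure_edge_lt_top e⟩
  have hσ : 0 < σ := (hM.isElement e.1.1).regularity_pos
  have hpos : ∀ x ∈ M.edge ΓD e, 0 < h x := fun x hx =>
    hh.pos hσ (edge_subset_elem (fst_mem_patch e) hx)
  have hsize := M.size_pos e.1.1
  have hinvh : ∀ x ∈ M.edge ΓD e, (h x)⁻¹ ≤ σ / M.size e.1.1 := fun x hx => by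
    rw [inv_le_comm₀ (hpos x hx) (div_pos hσ hsize), inv_div, div_le_iff₀' hσ]
    exact (hh.2 _ x (edge_subset_elem (fst_mem_patch e) hx)).1
  have weight : ∀ (n : ℕ) (χ : Pt → ℝ), MemLp χ 2 μ →
      Integrable (fun x => (h x ^ n)⁻¹ * χ x * χ x) μ := by
    intro n χ hχ
    simp only [mul_assoc]
    refine (hχ.integrable_mul hχ).bdd_mul (c := (σ / M.size e.1.1) ^ n)
      (hh.1.pow_const n).inv.aestronglyMeasurable ((ae_restrict_iff' hme).mpr
        (ae_of_all _ fun x hx => ?_))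
    have := hpos x hx
    rw [Real.norm_eq_abs, abs_of_pos (by positivity), ← inv_pow]
    exact pow_le_pow_left₀ (by positivity) (hinvh x hx) n
  have iφ : ∀ i, Integrable (fun x => (h x)⁻¹ * φ i x * φ i x) μ := fun i => by
    simpa only [pow_one] using weight 1 _ (hφ i)
  have iψ := weight 3 _ hψ
  have iR : Integrable (fun x => ∑ i, φ i x * normalAvg η e i x) μ :=
    integrable_finsetSum _ fun i _ => (hφ i).integrable_mul (hη.memLp_normalAvg hM hΩ e i)
  have iB : Integrable (fun x => ψ x * normalAvgDiv η e x) μ :=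
    hψ.integrable_mul (hη.memLp_normalAvgDiv hM hΩ e)
  have iJ : Integrable (fun x => ∑ i, (h x)⁻¹ * φ i x * φ i x + (h x ^ 3)⁻¹ * ψ x * ψ x) μ :=
    (integrable_finsetSum _ fun i _ => iφ i).add iψ
  -- Pointwise bound for the weighted averages: the inverse estimates give `h / H²` and `2 h³ / H⁴`
  -- times `C ‖η‖²`, and `h ≤ σ H` turns both into multiples of `1 / H`.
  set P := ∑ T ∈ M.patch e, (σ * C + 2 * σ ^ 3 * C) * ((M.size T)⁻¹ * M.elemIp T η η) with hP
  have hPx : ∀ x ∈ M.edge ΓD e, h x * ∑ i, normalAvg η e i x ^ 2 +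
      h x ^ 3 * normalAvgDiv η e x ^ 2 ≤ P := by
    intro x hx
    have h0 := hpos x hx
    refine (add_le_add (mul_le_mul_of_nonneg_left (sum_sq_normalAvg_le η e x) h0.le)
      (mul_le_mul_of_nonneg_left (sq_normalAvgDiv_le η e x) (pow_pos h0 3).le)).trans ?_
    rw [Finset.mul_sum, Finset.mul_sum, ← Finset.sum_add_distrib]
    refine Finset.sum_le_sum fun T hT => ?_
    have hxT := edge_subset_elem hT hx
    obtain ⟨a1, a2⟩ := hinv η hη T x hxT
    have hH := M.size_pos T
    have hle := (hh.2 T x hxT).2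
    have s1 : 0 ≤ ∑ i, ∑ j, η i j T x ^ 2 :=
      Finset.sum_nonneg fun _ _ => Finset.sum_nonneg fun _ _ => sq_nonneg _
    have s2 : 0 ≤ ∑ i, M.div η i T x ^ 2 := Finset.sum_nonneg fun _ _ => sq_nonneg _
    generalize ∑ i, ∑ j, η i j T x ^ 2 = X at *
    generalize ∑ i, M.div η i T x ^ 2 = Y at *
    have b1 : h x * X ≤ σ * M.size T * X := mul_le_mul_of_nonneg_right hle s1
    have b2 : h x ^ 3 * Y ≤ (σ * M.size T) ^ 3 * Y :=
      mul_le_mul_of_nonneg_right (pow_le_pow_left₀ h0.le hle 3) s2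
    refine (add_le_add b1 b2).trans (le_of_mul_le_mul_left ?_ hH)
    calc M.size T * (σ * M.size T * X + (σ * M.size T) ^ 3 * Y)
        = σ * (M.size T ^ 2 * X) + σ ^ 3 * (M.size T ^ 4 * Y) := by ring
      _ ≤ σ * (C * M.elemIp T η η) + σ ^ 3 * (2 * (C * M.elemIp T η η)) :=
          add_le_add (mul_le_mul_of_nonneg_left a1 hσ.le)
            (mul_le_mul_of_nonneg_left a2 (pow_pos hσ 3).le)
      _ = _ := by field_simp
  -- The weight `t` will be `h` for gradient jumps and `h³` for function jumps, matching the two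
  -- penalty terms.
  have young : ∀ t a b : ℝ, 0 < t → a * b ≤ A / 2 * (t⁻¹ * a * a) + (2 * A)⁻¹ * (t * b ^ 2) := by
    intro t a b ht
    have : A / 2 * (t⁻¹ * a * a) + (2 * A)⁻¹ * (t * b ^ 2) - a * b =
        (2 * A * t)⁻¹ * (A * a - t * b) ^ 2 := by
      field_simp
      ring
    have h2 : 0 ≤ (2 * A * t)⁻¹ * (A * a - t * b) ^ 2 := by positivity
    linarith
  -- The length of the edge, at most a multiple of `H`, cancels the factor `1 / H` in `P`.
  have hPi : P * μ.real Set.univ ≤ (σ * C + 2 * σ ^ 3 * C) * (σ * S.perimeter) *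
      ∑ T ∈ M.patch e, M.elemIp T η η := by
    rw [hP, Finset.sum_mul, Finset.mul_sum]
    refine Finset.sum_le_sum fun T hT => ?_
    have hH := M.size_pos T
    have hμT : μ.real Set.univ ≤ σ * M.size T * S.perimeter := by
      rw [measureReal_restrict_apply_univ]
      exact (hM.hausdorffMeasure_edge_le hT).2
    have hN := elemIp_self_nonneg T η
    refine (mul_le_mul_of_nonneg_left hμT (by positivity)).trans_eq ?_
    field_simp
  calc edgeB ΓD e ψ η - edgeR ΓD e φ η
      = ∫ x, (ψ x * normalAvgDiv η e x - ∑ i, φ i x * normalAvg η e i x) ∂μ :=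
        (integral_sub iB iR).symm
    _ ≤ ∫ x, (A / 2 * (∑ i, (h x)⁻¹ * φ i x * φ i x + (h x ^ 3)⁻¹ * ψ x * ψ x) +
          (2 * A)⁻¹ * P) ∂μ := by
        refine integral_mono_ae (iB.sub iR) ((iJ.const_mul _).add (integrable_const _))
          ((ae_restrict_iff' hme).mpr (ae_of_all _ fun x hx => ?_))
        have h0 := hpos x hx
        have y0 := young (h x) (φ 0 x) (-normalAvg η e 0 x) h0
        have y1 := young (h x) (φ 1 x) (-normalAvg η e 1 x) h0
        have y2 := young (h x ^ 3) (ψ x) (normalAvgDiv η e x) (pow_pos h0 3)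
        have y3 := mul_le_mul_of_nonneg_left (hPx x hx) (inv_pos.mpr (mul_pos two_pos hA)).le
        simp only [Fin.sum_univ_two, neg_sq] at *
        linarith
    _ = A / 2 * (∑ i, ∫ x, (h x)⁻¹ * φ i x * φ i x ∂μ + ∫ x, (h x ^ 3)⁻¹ * ψ x * ψ x ∂μ) +
          (2 * A)⁻¹ * (P * μ.real Set.univ) := by
        rw [integral_add (iJ.const_mul _) (integrable_const _), integral_const_mul,
          integral_add (integrable_finsetSum _ fun i _ => iφ i) iψ,
          integral_finsetSum _ fun i _ => iφ i, integral_const, smul_eq_mul]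
        ring
    _ ≤ _ := by
        gcongr

end Mesh

namespace Mesh

variable {S : Shape} {k : ℕ} {Ω : Set Pt} {M : Mesh S k Ω} {σ : ℝ} {ΓD : Set Pt}

/-! ### Finite overlap of the patches -/

/-- The number of elements that touch a given element is bounded in terms of the regularity. -/
theorem exists_card_touching_le (S : Shape) {σ : ℝ} (hσ : 0 < σ) :
    ∃ n : ℕ, ∀ {k : ℕ} {Ω : Set Pt} (M : Mesh S k Ω), M.ShapeRegular σ →
      ∀ h, M.IsDensity σ h → ∀ (T : Fin M.N) (s : Finset (Fin M.N)),
        (∀ T' ∈ s, (M.elem T ∩ M.elem T').Nonempty) → s.card ≤ n := by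
  have hv := S.volume_refInterior_pos
  set v := volume.real S.refInterior
  -- Area of a ball that contains all touching elements, divided by the least area of one of them:
  -- `σ⁴` comes from comparing sizes, `2 σ²` from the lower bound on the Jacobian.
  refine ⟨⌈2 * σ ^ 6 * ((1 + σ ^ 2) ^ 2 * Real.pi) / v⌉₊, fun M hM h hh T s hs => ?_⟩
  have hT := M.size_pos T
  -- Neighbouring sizes are compared through the value of `h` at a common point.
  have size_le : ∀ T' ∈ s, M.size T ≤ σ ^ 2 * M.size T' ∧ M.size T' ≤ σ ^ 2 * M.size T := by
    intro T' hT'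
    obtain ⟨x, hx, hx'⟩ := hs T' hT'
    have a := hh.2 T x hx
    have b := hh.2 T' x hx'
    constructor
    · calc M.size T ≤ σ * h x := a.1
        _ ≤ σ * (σ * M.size T') := mul_le_mul_of_nonneg_left b.2 hσ.le
        _ = _ := by ring
    · calc M.size T' ≤ σ * h x := b.1
        _ ≤ σ * (σ * M.size T) := mul_le_mul_of_nonneg_left a.2 hσ.le
        _ = _ := by ring
  obtain ⟨z, hz⟩ := S.refInterior_nonempty
  have hx₀ : M.F T z ∈ M.elem T := ⟨z, S.refInterior_subset hz, rfl⟩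
  have sub : ∀ T' ∈ s, M.elemInterior T' ⊆
      Metric.closedBall (M.F T z) ((1 + σ ^ 2) * M.size T) := by
    rintro T' hT' y ⟨w, hw, rfl⟩
    obtain ⟨x, hx, hx'⟩ := hs T' hT'
    rw [Metric.mem_closedBall]
    have h1 := M.dist_le_size T' ⟨w, S.refInterior_subset hw, rfl⟩ hx'
    have h2 := M.dist_le_size T hx hx₀
    have h3 := (size_le T' hT').2
    have h4 := dist_triangle (M.F T' w) x (M.F T z)
    linarith
  have lower : ∀ T' ∈ s, M.size T ^ 2 * v ≤ 2 * σ ^ 6 * volume.real (M.elemInterior T') := by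
    intro T' hT'
    have h1 := pow_le_pow_left₀ hT.le (size_le T' hT').1 2
    have h2 := (hM.isElement T').le_volume_image
    calc M.size T ^ 2 * v ≤ (σ ^ 2 * M.size T') ^ 2 * v := mul_le_mul_of_nonneg_right h1 hv.le
      _ = σ ^ 4 * (M.size T' ^ 2 * v) := by ring
      _ ≤ σ ^ 4 * (2 * σ ^ 2 * volume.real (M.elemInterior T')) :=
          mul_le_mul_of_nonneg_left h2 (by positivity)
      _ = _ := by ring
  have total : ∑ T' ∈ s, volume.real (M.elemInterior T') ≤
      ((1 + σ ^ 2) * M.size T) ^ 2 * Real.pi := by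
    rw [← measureReal_biUnion_finset (f := M.elemInterior)
      (fun i _ j _ hij => M.disjoint_interiors i j hij)
      (fun i _ => (hM.isElement i).measurableSet_image S.isOpen_refInterior.measurableSet
        S.refInterior_subset) (fun i _ => (hM.isElement i).volume_image_lt_top.ne)]
    refine (measureReal_mono (Set.iUnion₂_subset sub)
      Metric.isBounded_closedBall.measure_lt_top.ne).trans_eq ?_
    rw [measureReal_def, EuclideanSpace.volume_closedBall_fin_two, ENNReal.toReal_mul,
      ENNReal.toReal_pow, ENNReal.toReal_ofReal (by positivity),
      ENNReal.toReal_ofReal Real.pi_nonneg]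
  have h1 : (s.card : ℝ) * (M.size T ^ 2 * v) ≤
      2 * σ ^ 6 * (((1 + σ ^ 2) * M.size T) ^ 2 * Real.pi) := by
    rw [← nsmul_eq_mul]
    refine (Finset.card_nsmul_le_sum s _ _ lower).trans ?_
    rw [← Finset.mul_sum]
    exact mul_le_mul_of_nonneg_left total (by positivity)
  have h2 : (s.card : ℝ) ≤ 2 * σ ^ 6 * ((1 + σ ^ 2) ^ 2 * Real.pi) / v := by
    rw [le_div_iff₀ hv]
    refine le_of_mul_le_mul_left ?_ (pow_pos hT 2)
    calc M.size T ^ 2 * (s.card * v) = s.card * (M.size T ^ 2 * v) := by ring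
      _ ≤ _ := h1
      _ = _ := by ring
  exact_mod_cast h2.trans (Nat.le_ceil _)

open Classical in
/-- The number of edges whose patch contains a given element is bounded in terms of the
regularity. -/
theorem exists_card_edges_le (S : Shape) {σ : ℝ} (hσ : 0 < σ) :
    ∃ n : ℕ, ∀ {k : ℕ} {Ω : Set Pt} (M : Mesh S k Ω), M.ShapeRegular σ →
      ∀ h, M.IsDensity σ h → ∀ (ΓD : Set Pt) (T : Fin M.N),
        (Finset.univ.filter fun e : M.EdgeIdx =>
          (M.edge ΓD e).Nonempty ∧ T ∈ M.patch e).card ≤ n := by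
  obtain ⟨n, hn⟩ := exists_card_touching_le S hσ
  -- An active edge is a side and an optional second side, all of elements touching `T`; the `+ 1`
  -- counts boundary edges (`none`).
  refine ⟨n * S.sides * (n * S.sides + 1), fun M hM h hh ΓD T => ?_⟩
  set A := Finset.univ.filter fun T' : Fin M.N => (M.elem T ∩ M.elem T').Nonempty with hA
  have hAn : A.card ≤ n := hn M hM h hh T A fun T' hT' => (Finset.mem_filter.mp hT').2
  let B : Finset M.Side := A ×ˢ Finset.univ
  have hB : B.card ≤ n * S.sides := by
    rw [Finset.card_product, Finset.card_univ, Fintype.card_fin]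
    exact Nat.mul_le_mul_right _ hAn
  refine (Finset.card_le_card (t := B ×ˢ Finset.insertNone B) fun e he => ?_).trans ?_
  · obtain ⟨⟨x, hx⟩, hT⟩ := (Finset.mem_filter.mp he).2
    have key : ∀ T' ∈ M.patch e, T' ∈ A := fun T' hT' => Finset.mem_filter.mpr
      ⟨Finset.mem_univ _, x, edge_subset_elem hT hx, edge_subset_elem hT' hx⟩
    rw [Finset.mem_product]
    refine ⟨Finset.mem_product.mpr ⟨key _ (fst_mem_patch e), Finset.mem_univ _⟩, ?_⟩
    rw [Finset.mem_insertNone]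
    intro s' hs'
    refine Finset.mem_product.mpr ⟨key _ ?_, Finset.mem_univ _⟩
    obtain ⟨s, o⟩ := e
    obtain rfl : o = some s' := hs'
    simp [patch]
  · rw [Finset.card_product, Finset.card_insertNone]
    exact Nat.mul_le_mul hB (Nat.add_le_add_right hB 1)

/-! ### The inner product of tensor fields -/

/-- The `L²` inner product of tensor fields. -/
def tensorIp (τ η : M.Tensor) : ℝ := ∑ T, M.elemIp T τ η

theorem tensorIp_comm (τ η : M.Tensor) : tensorIp τ η = tensorIp η τ :=
  Finset.sum_congr rfl fun T _ => elemIp_comm T τ η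

theorem MemHess.tensorIp_eq (hM : M.ShapeRegular σ) {τ η : M.Tensor} (h : M.MemHess τ)
    (h' : M.MemHess η) : tensorIp τ η = ∑ i, ∑ j, M.ip (τ i j) (η i j) := by
  simp only [tensorIp, h.elemIp_eq hM h', ip]
  rw [Finset.sum_comm]
  exact Finset.sum_congr rfl fun i _ => Finset.sum_comm

theorem MemHess.tensorIp_smul_add (hM : M.ShapeRegular σ) {τ τ' η : M.Tensor} (h : M.MemHess τ)
    (h' : M.MemHess τ') (hη : M.MemHess η) (c : ℝ) :
    tensorIp (c • τ + τ') η = c * tensorIp τ η + tensorIp τ' η := by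
  simp only [tensorIp, h.elemIp_smul_add hM h' hη, Finset.sum_add_distrib, Finset.mul_sum]

theorem tensorIp_zero (η : M.Tensor) : tensorIp 0 η = 0 := by
  simp [tensorIp, elemIp]

theorem MemHess.tensorIp_sum (hM : M.ShapeRegular σ) {ι : Type*} (s : Finset ι)
    {τ : ι → M.Tensor} {η : M.Tensor} (h : ∀ i, M.MemHess (τ i)) (hη : M.MemHess η) :
    tensorIp (∑ i ∈ s, τ i) η = ∑ i ∈ s, tensorIp (τ i) η := by
  classical
  induction s using Finset.induction_on with
  | empty => exact tensorIp_zero η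
  | insert a s ha ih =>
    rw [Finset.sum_insert ha, Finset.sum_insert ha, ← ih, ← one_smul ℝ (τ a),
      tensorIp_smul_add hM (h a) (sum hM s h) hη, one_mul, one_smul]

/-- Extension by zero turns the defining identity on the patch into one for the global inner
product. -/
theorem IsLift.tensorIp_eq {e : M.EdgeIdx} {l : M.Tensor → ℝ} {τ : M.Tensor}
    (h : M.IsLift e l τ) {η : M.Tensor} (hη : M.MemHess η) : tensorIp τ η = l η := by
  rw [← h.2.2 η hη]
  refine (Finset.sum_subset (Finset.subset_univ (M.patch e)) fun T _ hT => ?_).symm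
  simp [elemIp, h.2.1 T hT]

/-! ### Symmetry of higher derivatives -/

/-- Both orders of differentiation produce the same numerator over the same power of `J`; this
includes the boundary of the element, where the edges lie. -/
theorem dh_comm_of_isRat (hM : M.ShapeRegular σ) {u : M.Broken} {m : ℕ} {q : Fin M.N → Poly}
    (hu : ∀ T, IsRat S (M.poly T) (M.F T) m (q T) (u T)) (i j : Fin 2) (T : Fin M.N) {x : Pt}
    (hx : x ∈ M.elem T) : M.dh i (M.dh j u) T x = M.dh j (M.dh i u) T x := by
  have E := hM.isElement T
  have h1 := E.isRat_pd (E.isRat_pd (hu T) j) i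
  rw [pdNum_comm] at h1
  exact h1.eq (E.isRat_pd (E.isRat_pd (hu T) i) j) hx

theorem MemV.exists_isRat {y : M.Broken} (hy : M.MemV y) :
    ∃ p : Fin M.N → Poly, ∀ T, IsRat S (M.poly T) (M.F T) 0 (p T) (y T) := by
  choose p _ hyp using hy
  exact ⟨p, fun T => isRat_zero_iff.mpr (hyp T)⟩

theorem MemV.hess_comm (hM : M.ShapeRegular σ) {y : M.Broken} (hy : M.MemV y) (i j : Fin 2)
    (T : Fin M.N) {x : Pt} (hx : x ∈ M.elem T) : M.hess y i j T x = M.hess y j i T x := by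
  obtain ⟨p, hp⟩ := hy.exists_isRat
  exact dh_comm_of_isRat hM hp i j T hx

/-- Permuting third derivatives identifies the term `∂_μ Δ_h y` of the energy with `div D²_h y · μ`,
the expression that defines `b_e`. -/
theorem MemV.dh_lap (hM : M.ShapeRegular σ) {y : M.Broken} (hy : M.MemV y) (i : Fin 2)
    (T : Fin M.N) {x : Pt} (hx : x ∈ M.elem T) :
    M.dh i (M.lap y) T x = M.div (M.hess y) i T x := by
  obtain ⟨p, hp⟩ := hy.exists_isRat
  have E := hM.isElement T
  have h1 : ∀ j T, IsRat S (M.poly T) (M.F T) 2 (pdNum (M.poly T) j 0 (p T)) (M.dh j y T) :=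
    fun j T => (hM.isElement T).isRat_pd (hp T) j
  have h2 : ∀ j, M.dh j (M.dh i (M.dh j y)) T x = M.dh i (M.dh j (M.dh j y)) T x := fun j =>
    dh_comm_of_isRat hM (h1 j) j i T hx
  have r := fun j => E.isRat_pd (h1 j T) j
  have h3 : M.lap y T = (1 : ℝ) • M.dh 0 (M.dh 0 y) T + M.dh 1 (M.dh 1 y) T := by
    rw [one_smul, lap, Fin.sum_univ_two]
    rfl
  have h4 := E.isRat_pd ((r 0).smul_add (r 1) 1) i
  rw [map_add, map_smul] at h4
  have h5 := h4.eq ((E.isRat_pd (r 0) i).smul_add (E.isRat_pd (r 1) i) 1) hx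
  have h6 : M.div (M.hess y) i T x =
      M.dh 0 (M.dh i (M.dh 0 y)) T x + M.dh 1 (M.dh i (M.dh 1 y)) T x := by
    rw [div, Fin.sum_univ_two]
    rfl
  rw [h6, h2 0, h2 1, dh, h3]
  refine h5.trans ?_
  rw [one_smul]
  rfl

theorem MemV.memHess {y : M.Broken} (hy : M.MemV y) : M.MemHess (M.hess y) :=
  ⟨y, hy, fun _ _ _ _ _ => rfl⟩

theorem MemV.continuousOn (hM : M.ShapeRegular σ) {y : M.Broken} (hy : M.MemV y) (T : Fin M.N) :
    ContinuousOn (y T) (M.elem T) := by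
  obtain ⟨p, hp⟩ := hy.exists_isRat
  exact (hM.isElement T).continuousOn_of_isRat (hp T)

theorem MemV.continuousOn_dh (hM : M.ShapeRegular σ) {y : M.Broken} (hy : M.MemV y) (j : Fin 2)
    (T : Fin M.N) : ContinuousOn (M.dh j y T) (M.elem T) := by
  obtain ⟨p, hp⟩ := hy.exists_isRat
  exact (hM.isElement T).continuousOn_of_isRat ((hM.isElement T).isRat_pd (hp T) j)

/-! ### The discrete energy and the discrete Hessian -/

/-- The threshold for one scalar component. -/
theorem exists_threshold (S : Shape) (k : ℕ) {σ : ℝ} (hσ : 0 < σ) :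
    ∃ γ : ℝ, 0 < γ ∧ ∀ γ₀ γ₁ : ℝ, γ ≤ γ₀ → γ ≤ γ₁ → ∀ {Ω : Set Pt} (ΓD : Set Pt), IsOpen Ω →
      ∀ M : Mesh S k Ω, M.ShapeRegular σ → ∀ h, M.IsDensity σ h →
      ∀ (g : Pt → ℝ) (Φ : Fin 2 → Pt → ℝ) (y : M.Broken), M.MemV y →
        ∑ i, ∑ j, M.ip (M.discreteHessian ΓD g Φ y i j) (M.discreteHessian ΓD g Φ y i j) ≤
          M.form ΓD h γ₀ γ₁ g Φ y g Φ y := by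
  classical
  obtain ⟨C, hC, hinv⟩ := exists_tensor_inverse_estimate S k hσ
  obtain ⟨n, hn⟩ := exists_card_edges_le S hσ
  set K := (σ * C + 2 * σ ^ 3 * C) * (σ * S.perimeter) with hK
  have hper : 0 ≤ S.perimeter := Finset.sum_nonneg fun _ _ => measureReal_nonneg
  have hK0 : 0 ≤ K := by positivity
  -- `K n` is the total inverse-estimate constant after summing over edges; the `+ 1` keeps `A`
  -- positive when it vanishes.
  set A := K * n + 1 with hA
  have hA0 : 0 < A := by positivity
  refine ⟨A, hA0, fun γ₀ γ₁ h₀ h₁ Ω ΓD hΩ M hM h hh g Φ y hy => ?_⟩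
  set φ : M.EdgeIdx → Fin 2 → Pt → ℝ := fun e j => M.jump ΓD (Φ j) (M.dh j y) e with hφdef
  set ψ : M.EdgeIdx → Pt → ℝ := M.jump ΓD g y with hψdef
  have hφ : ∀ e j, MemLp (φ e j) 2 ((μH[1]).restrict (M.edge ΓD e)) := fun e j =>
    hM.memLp_jump hΩ (hy.continuousOn_dh hM j) (Φ j) e
  have hψ : ∀ e, MemLp (ψ e) 2 ((μH[1]).restrict (M.edge ΓD e)) := fun e =>
    hM.memLp_jump hΩ (hy.continuousOn hM) g e
  have hR := fun e => isLift_liftR hM hΩ (hφ e)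
  have hB := fun e => isLift_liftB hM hΩ (hψ e)
  set R := ∑ e, M.liftR ΓD e (φ e) with hRdef
  set B := ∑ e, M.liftB ΓD e (ψ e) with hBdef
  have hRm : M.MemHess R := MemHess.sum hM _ fun e => (hR e).1
  have hBm : M.MemHess B := MemHess.sum hM _ fun e => (hB e).1
  have hD := hy.memHess
  set D := M.hess y with hDdef
  set Q := (-1 : ℝ) • R + B with hQdef
  have hQ : M.MemHess Q := hRm.smul_add hM hBm (-1)
  let L : M.Tensor → ℝ := fun η => ∑ e, (edgeB ΓD e (ψ e) η - edgeR ΓD e (φ e) η)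
  -- The key identity: it is used with `η = D` for the consistency terms and with `η = Q` for
  -- stability.
  have hQL : ∀ η, M.MemHess η → tensorIp Q η = L η := by
    intro η hη
    rw [hRm.tensorIp_smul_add hM hBm hη, MemHess.tensorIp_sum hM _ (fun e => (hR e).1) hη,
      MemHess.tensorIp_sum hM _ (fun e => (hB e).1) hη]
    simp only [(hR _).tensorIp_eq hη, (hB _).tensorIp_eq hη, L, Finset.sum_sub_distrib]
    ring
  have hHess : M.discreteHessian ΓD g Φ y = (1 : ℝ) • D + Q := by
    rw [one_smul, hQdef, neg_one_smul, ← add_assoc, ← sub_eq_add_neg]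
    rfl
  have hnorm : ∑ i, ∑ j, M.ip (M.discreteHessian ΓD g Φ y i j)
      (M.discreteHessian ΓD g Φ y i j) = tensorIp D D + 2 * L D + tensorIp Q Q := by
    have hDQ := hD.smul_add hM hQ 1
    rw [hHess, ← hDQ.tensorIp_eq hM hDQ, hD.tensorIp_smul_add hM hQ hDQ, tensorIp_comm D,
      tensorIp_comm Q, hD.tensorIp_smul_add hM hQ hD, hD.tensorIp_smul_add hM hQ hQ,
      tensorIp_comm D Q, hQL D hD]
    ring
  set J₁ := ∑ j, M.ipSkel ΓD (fun e x => (h x)⁻¹ * φ e j x) (fun e => φ e j) with hJ₁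
  set J₀ := M.ipSkel ΓD (fun e x => (h x ^ 3)⁻¹ * ψ e x) ψ with hJ₀
  have hpos : ∀ e, ∀ x ∈ M.edge ΓD e, 0 < h x := fun e x hx =>
    hh.pos hσ (edge_subset_elem (fst_mem_patch e) hx)
  have hJ₁0 : 0 ≤ J₁ := Finset.sum_nonneg fun j _ => Finset.sum_nonneg fun e _ =>
    setIntegral_nonneg (hM.measurableSet_edge hΩ e) fun x hx => by
      rw [mul_assoc]
      exact mul_nonneg (inv_pos.mpr (hpos e x hx)).le (mul_self_nonneg _)
  have hJ₀0 : 0 ≤ J₀ := Finset.sum_nonneg fun e _ =>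
    setIntegral_nonneg (hM.measurableSet_edge hΩ e) fun x hx => by
      rw [mul_assoc]
      exact mul_nonneg (inv_pos.mpr (pow_pos (hpos e x hx) 3)).le (mul_self_nonneg _)
  have hJ : J₁ + J₀ = ∑ e, (∑ i, ∫ x in M.edge ΓD e, (h x)⁻¹ * φ e i x * φ e i x ∂μH[1] +
      ∫ x in M.edge ΓD e, (h x ^ 3)⁻¹ * ψ e x * ψ e x ∂μH[1]) := by
    rw [Finset.sum_add_distrib, Finset.sum_comm]
    rfl
  have hform : M.form ΓD h γ₀ γ₁ g Φ y g Φ y = tensorIp D D + 2 * L D + γ₁ * J₁ + γ₀ * J₀ := by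
    have hg : ∑ j, M.ipSkel ΓD (M.avgNormalGrad y j) (M.jump ΓD (Φ j) (M.dh j y)) =
        ∑ e, edgeR ΓD e (φ e) D := by
      simp only [ipSkel]
      rw [Finset.sum_comm]
      refine Finset.sum_congr rfl fun e _ => ?_
      have hi : ∀ i ∈ Finset.univ, Integrable (fun x => φ e i x * normalAvg D e i x)
          ((μH[1]).restrict (M.edge ΓD e)) := fun i _ =>
        (hφ e i).integrable_mul (hD.memLp_normalAvg hM hΩ e i)
      rw [edgeR, integral_finsetSum _ hi]
      refine Finset.sum_congr rfl fun j _ =>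
        setIntegral_congr_fun (hM.measurableSet_edge hΩ e) fun x hx => ?_
      -- The energy contracts `μ` with the first index of the Hessian, the lifting with the second.
      have hs : ∀ i, M.avg (M.hess y i j) e x = M.avg (M.hess y j i) e x := fun i =>
        avg_congr fun T hT => hy.hess_comm hM i j T (edge_subset_elem hT hx)
      simp only [avgNormalGrad, normalAvg, hs, hφdef, hDdef]
      ring
    have hl : M.ipSkel ΓD (M.avgNormalLap y) (M.jump ΓD g y) = ∑ e, edgeB ΓD e (ψ e) D := by
      refine Finset.sum_congr rfl fun e _ =>
        setIntegral_congr_fun (hM.measurableSet_edge hΩ e) fun x hx => ?_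
      have hs : ∀ i, M.avg (M.dh i (M.lap y)) e x = M.avg (M.div (M.hess y) i) e x := fun i =>
        avg_congr fun T hT => hy.dh_lap hM i T (edge_subset_elem hT hx)
      simp only [avgNormalLap, normalAvgDiv, hs, hψdef, hDdef]
      ring
    rw [form, hg, hl, ← hD.tensorIp_eq hM hD]
    simp only [L, Finset.sum_sub_distrib]
    ring
  have hQQ : tensorIp Q Q ≤ A / 2 * (J₁ + J₀) + (2 * A)⁻¹ * (K * (n * tensorIp Q Q)) := by
    have hterm : ∀ e, edgeB ΓD e (ψ e) Q - edgeR ΓD e (φ e) Q ≤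
        A / 2 * (∑ i, ∫ x in M.edge ΓD e, (h x)⁻¹ * φ e i x * φ e i x ∂μH[1] +
          ∫ x in M.edge ΓD e, (h x ^ 3)⁻¹ * ψ e x * ψ e x ∂μH[1]) +
        (2 * A)⁻¹ * (K * ∑ T, if (M.edge ΓD e).Nonempty ∧ T ∈ M.patch e
          then M.elemIp T Q Q else 0) := by
      intro e
      -- Indices of empty edges contribute nothing and must be dropped: the overlap bound counts
      -- nonempty edges only.
      rcases (M.edge ΓD e).eq_empty_or_nonempty with he | he
      · simp [edgeB, edgeR, he]
      · simpa [he] using edgeB_sub_edgeR_le hM hΩ hh hC (hinv M hM) (hφ e) (hψ e) hQ hA0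
    conv_lhs => rw [hQL Q hQ]
    refine (Finset.sum_le_sum fun e _ => hterm e).trans ?_
    rw [Finset.sum_add_distrib, ← Finset.mul_sum, ← Finset.mul_sum, ← Finset.mul_sum, ← hJ,
      Finset.sum_comm]
    refine add_le_add le_rfl (mul_le_mul_of_nonneg_left (mul_le_mul_of_nonneg_left ?_ hK0)
      (by positivity))
    rw [tensorIp, Finset.mul_sum]
    refine Finset.sum_le_sum fun T _ => ?_
    rw [← Finset.sum_filter, Finset.sum_const, nsmul_eq_mul]
    exact mul_le_mul_of_nonneg_right (by exact_mod_cast hn M hM h hh ΓD T)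
      (elemIp_self_nonneg T Q)
  have hQ0 : 0 ≤ tensorIp Q Q := Finset.sum_nonneg fun T _ => elemIp_self_nonneg T Q
  have hfinal : tensorIp Q Q ≤ A * (J₁ + J₀) := by
    -- Absorption: `K n = A - 1`, so less than half of `‖Q‖²` is moved to the left whenever it is
    -- nonzero.
    have h1 : (2 * A)⁻¹ * (K * (n * tensorIp Q Q)) ≤ tensorIp Q Q / 2 := by
      rw [inv_mul_le_iff₀ (by positivity)]
      have : K * (n * tensorIp Q Q) = (A - 1) * tensorIp Q Q := by rw [hA]; ring
      rw [this]
      linarith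
    linarith
  rw [hnorm, hform]
  have e1 := mul_le_mul_of_nonneg_right h₁ hJ₁0
  have e0 := mul_le_mul_of_nonneg_right h₀ hJ₀0
  linarith

end Mesh

end PlateDG

end

/-- The penalty threshold `γ` depends only on the kind of reference element, on the degree `k` and on
the regularity constant `σ` of the mesh and of the mesh density function. -/
theorem proposition4p6 (S : PlateDG.Shape) (k : ℕ) (hk : 2 ≤ k) (σ : ℝ) :
    ∃ γ : ℝ, 0 < γ ∧ ∀ γ₀ γ₁ : ℝ, γ ≤ γ₀ → γ ≤ γ₁ →
      ∀ (Ω ΓD : Set PlateDG.Pt), IsOpen Ω → ΓD.Nonempty →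
        (∃ U : Set PlateDG.Pt, IsOpen U ∧ ΓD = U ∩ frontier Ω) →
      ∀ M : PlateDG.Mesh S k Ω, M.ShapeRegular σ →
      ∀ h : PlateDG.Pt → ℝ, M.IsDensity σ h →
      ∀ (g : Fin 3 → PlateDG.Pt → ℝ) (Φ : Fin 3 → Fin 2 → PlateDG.Pt → ℝ)
        (f : Fin 3 → PlateDG.Pt → ℝ),
        (∀ n, PlateDG.MemH1 Ω (g n)) → (∀ n j, PlateDG.MemH1 Ω (Φ n j)) →
        (∀ n, MemLp (f n) 2 (volume.restrict Ω)) →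
      ∀ y : Fin 3 → M.Broken, (∀ n, M.MemV (y n)) →
        1 / 2 * M.hessianNormSq ΓD g Φ y - M.load f y ≤ M.energy ΓD h γ₀ γ₁ g Φ f y := by
  rcases le_or_gt σ 0 with hσ | hσ
  -- An element forces `σ > 0`; without elements all sums are empty and both sides are zero.
  · refine ⟨1, one_pos, fun γ₀ γ₁ _ _ Ω ΓD _ _ _ M hM h _ g Φ f _ _ _ y _ => ?_⟩
    have hN : IsEmpty (Fin M.N) := ⟨fun T => hσ.not_gt (hM.isElement T).regularity_pos⟩
    simp [PlateDG.Mesh.hessianNormSq, PlateDG.Mesh.energy, PlateDG.Mesh.form, PlateDG.Mesh.ip,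
      PlateDG.Mesh.ipSkel]
  · obtain ⟨γ, hγ, H⟩ := PlateDG.Mesh.exists_threshold S k hσ
    refine ⟨γ, hγ, fun γ₀ γ₁ h₀ h₁ Ω ΓD hΩ _ _ M hM h hh g Φ f _ _ _ y hy => ?_⟩
    refine sub_le_sub_right (mul_le_mul_of_nonneg_left (Finset.sum_le_sum fun n _ => ?_)
      (by norm_num)) _
    exact H γ₀ γ₁ h₀ h₁ ΓD hΩ M hM h hh (g n) (Φ n) (y n) (hy n)
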